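/- Let $\mathbb{F}\in\{\mathbb{R},\mathbb{C}\}$, let $d\ge 1$ be an integer and let $s,r,\delta\in\mathbb{R}$. For $\xi\in\mathbb{R}^d$ put $$\omega_{s,r,\delta}(\xi)=\begin{cases}\dfrac{|\xi_1|^2+|\xi|^{2\delta}}{|\xi|^{2r}}, & |\xi|<1,\\[2mm] (1+|\xi|^2)^{s}, & |\xi|\ge 1,\end{cases}$$ and let $X^s_{r,\delta}(\mathbb{R}^d;\mathbb{F})$ be the space of $\mathbb{F}$-valued tempered distributions $f$ on $\mathbb{R}^d$ whose Fourier transform $\hat f$ is a locally integrable function with $$\|f\|_{X^s_{r,\delta}}^2=\int_{\mathbb{R}^d}\omega_{s,r,\delta}(\xi)\,|\hat f(\xi)|^2\,d\xi<\infty .$$ (Here $\hat f(\xi)=\int f(x)e^{-2\pi i x\cdot\xi}\,dx$ for integrable $f$.) We say that $X^s_{r,\delta}(\mathbb{R}^d;\mathbb{F})$ is an algebra if its elements are functions, the pointwise product $fg$ of any two elements $f,g$ belongs to the space, and there is a constant $C>0$ such that $\|fg\|_{X^s_{r,\delta}}\le C\|f\|_{X^s_{r,\delta}}\|g\|_{X^s_{r,\delta}}$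 for all $f,g$ in the space. Assume $\delta>1$, $d>1+\delta-2r$, $r\le 1$ and $s>d/2$. Then, for both $\mathbb{F}=\mathbb{R}$ and $\mathbb{F}=\mathbb{C}$: 1. If $d\ge 3$, then $X^s_{r,\delta}(\mathbb{R}^d;\mathbb{F})$ is an algebra. 2. If $d=2$, then $X^s_{r,\delta}(\mathbb{R}^d;\mathbb{F})$ is an algebra if and only if $\delta\le 2$. The same equivalence holds if the norm inequality is not required, that is: $X^s_{r,\delta}(\mathbb{R}^2;\mathbb{F})$ is closed under pointwise multiplication if and only if $\delta\le 2$. -/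

import Mathlib

open MeasureTheory Metric
open scoped ENNReal SchwartzMap FourierTransform ContDiff

noncomputable section

namespace AnisoSobolev

/-- The Euclidean space `ℝ^d`. -/
abbrev Space (d : ℕ) : Type := EuclideanSpace ℝ (Fin d)

variable {d : ℕ}

/-- The tempered distribution `f` is (given by) the locally integrable function `u`:
`f` and `u` agree as distributions, i.e. against all compactly supported smooth functions. -/
def IsGivenBy (f : 𝓢'(Space d, ℂ)) (u : Space d → ℂ) : Prop :=
  LocallyIntegrable u ∧
    ∀ φ : 𝓢(Space d, ℂ), HasCompactSupport (φ : Space d → ℂ) → f φ = ∫ x, φ x * u x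

/-- The locally integrable function that gives a distribution is unique almost everywhere. -/
theorem IsGivenBy.ae_eq {f : 𝓢'(Space d, ℂ)} {u v : Space d → ℂ}
    (hu : IsGivenBy f u) (hv : IsGivenBy f v) : u =ᵐ[volume] v := by
  refine ae_eq_of_integral_contDiff_smul_eq hu.1 hv.1 fun g g_smooth g_cpt => ?_
  have hg₁ : HasCompactSupport (Complex.ofRealCLM ∘ g) := g_cpt.comp_left rfl
  have hg₂ : ContDiff ℝ ∞ (Complex.ofRealCLM ∘ g) := by fun_prop
  have h := (hu.2 (hg₁.toSchwartzMap hg₂) hg₁).symm.trans (hv.2 (hg₁.toSchwartzMap hg₂) hg₁)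
  simpa using h

theorem IsGivenBy.integrable_mul {f : 𝓢'(Space d, ℂ)} {u : Space d → ℂ} (hu : IsGivenBy f u)
    {φ : 𝓢(Space d, ℂ)} (hφ : HasCompactSupport (φ : Space d → ℂ)) :
    Integrable (fun x => φ x * u x) := by
  have h := hu.1.integrable_smul_left_of_hasCompactSupport φ.continuous hφ
  simpa using h

theorem isGivenBy_zero : IsGivenBy (0 : 𝓢'(Space d, ℂ)) (fun _ => 0) :=
  ⟨locallyIntegrable_zero, fun φ _ => by simp⟩

theorem IsGivenBy.add {f g : 𝓢'(Space d, ℂ)} {u v : Space d → ℂ}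
    (hu : IsGivenBy f u) (hv : IsGivenBy g v) : IsGivenBy (f + g) (fun x => u x + v x) := by
  refine ⟨hu.1.add hv.1, fun φ hφ => ?_⟩
  have h := integral_add (hu.integrable_mul hφ) (hv.integrable_mul hφ)
  simp only [mul_add]
  rw [h, ← hu.2 φ hφ, ← hv.2 φ hφ]
  rfl

theorem IsGivenBy.smul {f : 𝓢'(Space d, ℂ)} {u : Space d → ℂ} (c : ℂ)
    (hu : IsGivenBy f u) : IsGivenBy (c • f) (fun x => c * u x) := by
  refine ⟨hu.1.smul c, fun φ hφ => ?_⟩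
  have h := integral_const_mul (μ := volume) c (fun x => φ x * u x)
  simp only [mul_left_comm _ c]
  rw [h, ← hu.2 φ hφ]
  rfl

/-- The weight `ω_{s,r,δ}`, equal to `(|ξ₁|² + |ξ|^{2δ}) / |ξ|^{2r}` for `|ξ| < 1` and to
`⟨ξ⟩^{2s} = (1 + |ξ|²)^s` for `|ξ| ≥ 1`. -/
def weight [NeZero d] (s r δ : ℝ) (ξ : Space d) : ℝ :=
  (ball (0 : Space d) 1).indicator
      (fun ξ => (|ξ 0| ^ 2 + ‖ξ‖ ^ (2 * δ)) / ‖ξ‖ ^ (2 * r)) ξ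
    + (ball (0 : Space d) 1)ᶜ.indicator (fun ξ => Real.sqrt (1 + ‖ξ‖ ^ 2) ^ (2 * s)) ξ

theorem measurable_weight [NeZero d] (s r δ : ℝ) :
    Measurable (weight s r δ : Space d → ℝ) := by
  unfold weight
  refine Measurable.add (Measurable.indicator ?_ measurableSet_ball)
    (Measurable.indicator ?_ measurableSet_ball.compl)
  · have h : Measurable fun ξ : Space d => ξ 0 := by fun_prop
    have h' : Measurable fun ξ : Space d => |ξ 0| := by
      simpa only [← Real.norm_eq_abs] using h.norm
    exact ((h'.pow_const 2).add (measurable_norm.pow_const _)).div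
      (measurable_norm.pow_const _)
  · fun_prop

/-- `∫ ω_{s,r,δ}(ξ) |w(ξ)|² dξ`, with values in `[0, ∞]`. -/
def energy [NeZero d] (s r δ : ℝ) (w : Space d → ℂ) : ℝ≥0∞ :=
  ∫⁻ ξ, ENNReal.ofReal (weight s r δ ξ) * ‖w ξ‖ₑ ^ 2

theorem energy_congr [NeZero d] (s r δ : ℝ) {w w' : Space d → ℂ} (h : w =ᵐ[volume] w') :
    energy s r δ w = energy s r δ w' :=
  lintegral_congr_ae (h.mono fun ξ hξ => by simp only [hξ])

theorem energy_add_lt_top [NeZero d] (s r δ : ℝ) {w w' : Space d → ℂ}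
    (hm : AEStronglyMeasurable w volume)
    (h : energy s r δ w < ⊤) (h' : energy s r δ w' < ⊤) :
    energy s r δ (fun ξ => w ξ + w' ξ) < ⊤ := by
  have key : energy s r δ (fun ξ => w ξ + w' ξ) ≤
      ∫⁻ ξ, (2 * (ENNReal.ofReal (weight s r δ ξ) * ‖w ξ‖ₑ ^ 2)
        + 2 * (ENNReal.ofReal (weight s r δ ξ) * ‖w' ξ‖ₑ ^ 2)) := by
    refine lintegral_mono fun ξ => ?_
    have h1 : ‖w ξ + w' ξ‖ₑ ^ 2 ≤ 2 * (‖w ξ‖ₑ ^ 2 + ‖w' ξ‖ₑ ^ 2) := by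
      have h2 := ENNReal.rpow_add_le_mul_rpow_add_rpow ‖w ξ‖ₑ ‖w' ξ‖ₑ
        (p := 2) (by norm_num)
      have h3 : (2 : ℝ≥0∞) ^ ((2 : ℝ) - 1) = 2 := by norm_num
      rw [h3] at h2
      simp only [ENNReal.rpow_ofNat] at h2
      exact (pow_le_pow_left' (enorm_add_le _ _) 2).trans h2
    calc _ ≤ ENNReal.ofReal (weight s r δ ξ) * (2 * (‖w ξ‖ₑ ^ 2 + ‖w' ξ‖ₑ ^ 2)) := by gcongr
      _ = _ := by ring
  refine key.trans_lt ?_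
  have hme : AEMeasurable (fun ξ => 2 * (ENNReal.ofReal (weight s r δ ξ) * ‖w ξ‖ₑ ^ 2))
      volume :=
    (((measurable_weight s r δ).ennreal_ofReal.aemeasurable).mul
      (hm.enorm.pow_const 2)).const_mul 2
  rw [lintegral_add_left' hme, lintegral_const_mul' _ _ (by norm_num),
    lintegral_const_mul' _ _ (by norm_num)]
  exact ENNReal.add_lt_top.2 ⟨ENNReal.mul_lt_top (by norm_num) h,
    ENNReal.mul_lt_top (by norm_num) h'⟩

theorem energy_smul_lt_top [NeZero d] (s r δ : ℝ) (c : ℂ) {w : Space d → ℂ}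
    (h : energy s r δ w < ⊤) : energy s r δ (fun ξ => c * w ξ) < ⊤ := by
  have key : energy s r δ (fun ξ => c * w ξ) = ‖c‖ₑ ^ 2 * energy s r δ w := by
    unfold energy
    rw [← lintegral_const_mul' _ _ (by simp)]
    refine lintegral_congr fun ξ => ?_
    rw [enorm_mul, mul_pow]
    ring
  rw [key]
  exact ENNReal.mul_lt_top (by simp) h

/-- The space `X^s_{r,δ}(ℝ^d; ℂ)`: tempered distributions `f` whose Fourier transform is a
locally integrable function `w` with `∫ ω_{s,r,δ} |w|² < ∞`. -/
def X (d : ℕ) [NeZero d] (s r δ : ℝ) : Submodule ℂ 𝓢'(Space d, ℂ) where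
  carrier := {f | ∃ w, IsGivenBy (𝓕 f) w ∧ energy s r δ w < ⊤}
  zero_mem' := ⟨fun _ => 0, by simpa [FourierTransform.fourier_zero] using isGivenBy_zero,
    by simp [energy]⟩
  add_mem' := by
    rintro f g ⟨u, hu, hu'⟩ ⟨v, hv, hv'⟩
    refine ⟨_, ?_, energy_add_lt_top s r δ hu.1.aestronglyMeasurable hu' hv'⟩
    rw [FourierTransform.fourier_add]
    exact hu.add hv
  smul_mem' := by
    rintro c f ⟨u, hu, hu'⟩
    refine ⟨_, ?_, energy_smul_lt_top s r δ c hu'⟩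
    rw [FourierTransform.fourier_smul]
    exact hu.smul c

/-- The real-valued tempered distributions: those that are real on real-valued test functions. -/
def realDistributions (d : ℕ) : Submodule ℝ 𝓢'(Space d, ℂ) where
  carrier := {f | ∀ φ : 𝓢(Space d, ℂ), (∀ x, (φ x).im = 0) → (f φ).im = 0}
  zero_mem' := fun φ _ => by simp
  add_mem' := fun {f g} hf hg φ hφ => by
    have h : (f + g) φ = f φ + g φ := rfl
    rw [h, Complex.add_im, hf φ hφ, hg φ hφ, add_zero]
  smul_mem' := fun c f hf φ hφ => by
    have h : (c • f) φ = c • f φ := rfl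
    rw [h, Complex.smul_im, hf φ hφ, smul_zero]

/-- The space `X^s_{r,δ}(ℝ^d; ℝ)`: the real-valued elements of `X^s_{r,δ}(ℝ^d; ℂ)`. -/
def XReal (d : ℕ) [NeZero d] (s r δ : ℝ) : Submodule ℝ 𝓢'(Space d, ℂ) :=
  (X d s r δ).restrictScalars ℝ ⊓ realDistributions d

open Classical in
/-- The Fourier transform of `f` as a function, when it is a locally integrable function
(and `0` otherwise); well defined up to null sets. -/
def fourierFun (f : 𝓢'(Space d, ℂ)) : Space d → ℂ :=
  if h : ∃ w, IsGivenBy (𝓕 f) w then h.choose else 0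

/-- The norm `‖f‖ = (∫ ω_{s,r,δ} |f̂|²)^{1/2}` (a genuine, finite norm on `X d s r δ`). -/
def xNorm [NeZero d] (s r δ : ℝ) (f : 𝓢'(Space d, ℂ)) : ℝ :=
  Real.sqrt (energy s r δ (fourierFun f)).toReal

/-- The norm can be computed from any function that represents the Fourier transform. -/
theorem xNorm_eq [NeZero d] (s r δ : ℝ) {f : 𝓢'(Space d, ℂ)} {w : Space d → ℂ}
    (hw : IsGivenBy (𝓕 f) w) : xNorm s r δ f = Real.sqrt (energy s r δ w).toReal := by
  have h : ∃ w, IsGivenBy (𝓕 f) w := ⟨w, hw⟩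
  have h' : fourierFun f =ᵐ[volume] w := by
    rw [fourierFun, dif_pos h]
    exact h.choose_spec.ae_eq hw
  rw [xNorm, energy_congr s r δ h']

/-- `h` is the pointwise product of `f` and `g`: the three distributions are locally integrable
functions, and the function `h` is the pointwise product of the functions `f` and `g`. -/
def IsPointwiseProduct (f g h : 𝓢'(Space d, ℂ)) : Prop :=
  ∃ u v : Space d → ℂ, IsGivenBy f u ∧ IsGivenBy g v ∧ IsGivenBy h (fun x => u x * v x)

/-- The set `V` is closed under pointwise multiplication. -/
def ClosedUnderMul (V : Set 𝓢'(Space d, ℂ)) : Prop :=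
  ∀ f ∈ V, ∀ g ∈ V, ∃ h ∈ V, IsPointwiseProduct f g h

/-- The set `V`, with the norm `N`, is closed under pointwise multiplication, and
multiplication is bounded: `N (f g) ≤ C N(f) N(g)` for some constant `C`. -/
def BoundedMul (V : Set 𝓢'(Space d, ℂ)) (N : 𝓢'(Space d, ℂ) → ℝ) : Prop :=
  ∃ C : ℝ, 0 < C ∧ ∀ f ∈ V, ∀ g ∈ V, ∃ h ∈ V,
    IsPointwiseProduct f g h ∧ N h ≤ C * N f * N g

end AnisoSobolev

end

noncomputable section

namespace AnisoSobolev

open Filter Topology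

/-! Write d = n + 1 and W for the weight; the hypothesis on d becomes δ - 2r < n. With s > d/2 it
makes 1/W integrable (`lintegral_inv_weight_lt_top`). By Cauchy–Schwarz, finite energy then forces
an integrable Fourier transform, so products of elements are continuous functions whose transforms
are convolutions (`exists_mul`), and everything reduces to the energy of F * G.

Positive part. By `lintegral_conv_sq_le` it suffices to bound W(η + ζ) / (W(η) W(ζ)) by kernels with
uniformly bounded integrals: in η at fixed ζ, in ζ at fixed η, or in η at fixed η + ζ. Where W(η +
ζ) ≲ W(η) + W(ζ), the kernels 1/W suffice. The exceptions are, for r > 0, two comparable low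
frequencies with a much lower sum and, for r ≤ 0, a low frequency meeting a lower one. Their kernels
contain a Cauchy kernel in the first coordinate whose width is the δ-th power of the frequency size,
and Fubini bounds their integrals by a power of that size, which is at most 1. For r ≤ 0 the
exponent is n + 2r - δ > 0. For r > 0 an interpolation parameter a in [0, 2] gives the exponent n +
2r - δ - a(δ - 1): a = 0 works if 2r < n and a small a > 0 if 2r = n. If 2r > n, then r ≤ 1 forces n
= 1, and a = 2r - 1 yields 2r(2 - δ), which is nonnegative exactly when δ ≤ 2. This is `boundedMul`.

Negative part. For d = 2 and δ > 2, the hypotheses give r > 0. Let F be |η₂|^(-β) on the cusp |η₁| ≤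
|η₂|^δ near the origin. Its energy is finite if 4β < 6δ - 4r + 2. Opposite arms of the cusp interact
to make F * F large on boxes of side about R^δ, which contribute at least a multiple of R^(6δ + 2 -
2rδ - 4β) to the energy, unbounded as R → 0 if 4β > 6δ + 2 - 2rδ. The two conditions on β are
compatible because δ > 2. Since F is real and even, the example is a real-valued function
(`not_closedUnderMul_of_two_lt`). -/

/-! ### Density of compactly supported test functions -/

/-- The chain rule only contributes factors c of modulus at most 1. The uniformity in c controls the
cut-offs χ(x / (n + 1)) used next. -/
theorem exists_norm_iteratedFDeriv_comp_smul_le {E : Type*} [NormedAddCommGroup E]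
    [NormedSpace ℝ E] {χ : E → ℂ} (h : ContDiff ℝ ∞ χ) (hc : HasCompactSupport χ) (i : ℕ) :
    ∃ M : ℝ, 0 ≤ M ∧ ∀ c : ℝ, |c| ≤ 1 → ∀ x, ‖iteratedFDeriv ℝ i (fun y => χ (c • y)) x‖ ≤ M := by
  obtain ⟨M, hM⟩ := (hc.iteratedFDeriv (𝕜 := ℝ) i).exists_bound_of_continuous
    (h.continuous_iteratedFDeriv (m := i) (mod_cast le_top))
  refine ⟨M, (norm_nonneg _).trans (hM 0), fun c hc' x => ?_⟩
  have h1 : (fun y => χ (c • y)) = χ ∘ (c • ContinuousLinearMap.id ℝ E) := by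
    ext; simp
  rw [h1, ContinuousLinearMap.iteratedFDeriv_comp_right _ h x (i := i) (mod_cast le_top)]
  refine (ContinuousMultilinearMap.norm_compContinuousLinearMap_le _ _).trans ?_
  refine (mul_le_of_le_one_right (norm_nonneg _) ?_).trans (hM _)
  refine Finset.prod_le_one (fun _ _ => norm_nonneg _) fun _ _ => ?_
  refine (norm_smul_le _ _).trans ?_
  exact mul_le_one₀ hc' (norm_nonneg _) ContinuousLinearMap.norm_id_le

/-- Schwartz functions are limits of compactly supported ones. -/
theorem exists_tendsto_hasCompactSupport {E : Type*} [NormedAddCommGroup E]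
    [InnerProductSpace ℝ E] [FiniteDimensional ℝ E] (φ : 𝓢(E, ℂ)) :
    ∃ ψ : ℕ → 𝓢(E, ℂ), (∀ n, HasCompactSupport (ψ n : E → ℂ)) ∧ Tendsto ψ atTop (𝓝 φ) := by
  let b : ContDiffBump (0 : E) := ⟨1, 2, one_pos, one_lt_two⟩
  let χ : E → ℂ := Complex.ofRealCLM ∘ b
  have hχ : ContDiff ℝ ∞ χ := Complex.ofRealCLM.contDiff.comp b.contDiff
  have hχc : HasCompactSupport χ := b.hasCompactSupport.comp_left rfl
  have hχ1 : ∀ x : E, ‖x‖ ≤ 1 → χ x = 1 := fun x hx => by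
    have : b x = 1 := b.one_of_mem_closedBall (by simpa using hx)
    simp [χ, this]
  let c : ℕ → ℝ := fun n => ((n : ℝ) + 1)⁻¹
  have hc0 : ∀ n, 0 < c n := fun n => by positivity
  have hc1 : ∀ n, |c n| ≤ 1 := fun n => by
    rw [abs_of_pos (hc0 n)]
    exact inv_le_one_of_one_le₀ (by simp)
  have hcd : ∀ n, ContDiff ℝ ∞ (fun x => χ (c n • x)) := fun n =>
    hχ.comp (contDiff_const_smul _)
  have hcc : ∀ n, HasCompactSupport (fun x => χ (c n • x)) := fun n =>
    hχc.comp_smul (hc0 n).ne'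
  have hP : ∀ n, HasCompactSupport (fun x => χ (c n • x) * φ x) := fun n => (hcc n).mul_right
  have hPd : ∀ n, ContDiff ℝ ∞ (fun x => χ (c n • x) * φ x) := fun n =>
    (hcd n).mul (φ.smooth ⊤)
  refine ⟨fun n => (hP n).toSchwartzMap (hPd n), fun n => hP n, ?_⟩
  rw [(schwartz_withSeminorms ℂ E ℂ).tendsto_nhds]
  rintro ⟨k, N⟩ ε hε
  choose M hM0 hM using fun i => exists_norm_iteratedFDeriv_comp_smul_le hχ hχc i
  let B : ℝ := ∑ i ∈ Finset.range (N + 1), (N.choose i : ℝ) * M i *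
    SchwartzMap.seminorm ℂ (k + 1) (N - i) φ + SchwartzMap.seminorm ℂ (k + 1) N φ
  have hB : 0 ≤ B := add_nonneg (Finset.sum_nonneg fun i _ =>
    mul_nonneg (mul_nonneg (Nat.cast_nonneg _) (hM0 i)) (apply_nonneg _ _)) (apply_nonneg _ _)
  have key : ∀ n, SchwartzMap.seminorm ℂ k N ((hP n).toSchwartzMap (hPd n) - φ) ≤ c n * B := by
    intro n
    refine SchwartzMap.seminorm_le_bound _ _ _ _ (mul_nonneg (hc0 n).le hB) fun x => ?_
    have hcoe : ((((hP n).toSchwartzMap (hPd n) - φ : 𝓢(E, ℂ))) : E → ℂ)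
        = (fun x => χ (c n • x) * φ x) - φ := rfl
    rw [hcoe]
    rcases lt_or_ge ‖x‖ ((c n)⁻¹) with hx | hx
    · have h0 : ((fun x => χ (c n • x) * φ x) - φ : E → ℂ) =ᶠ[𝓝 x] fun _ => 0 := by
        have : ∀ᶠ y in 𝓝 x, ‖y‖ < (c n)⁻¹ := continuous_norm.continuousAt.eventually_lt_const hx
        filter_upwards [this] with y hy
        have : χ (c n • y) = 1 := hχ1 _ (by
          rw [norm_smul, Real.norm_of_nonneg (hc0 n).le]
          exact ((lt_inv_mul_iff₀ (hc0 n)).1 (by simpa using hy)).le)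
        simp [this]
      rw [(h0.iteratedFDeriv ℝ N).eq_of_nhds]
      have : iteratedFDeriv ℝ N (fun _ : E => (0 : ℂ)) x = 0 := by
        rw [iteratedFDeriv_fun_zero]; rfl
      rw [this]
      simpa using mul_nonneg (hc0 n).le hB
    -- Outside the region where the cut-off is 1, one extra power of ‖x‖ is traded for the small
    -- factor `c n`; this is why `B` contains seminorms of order k + 1.
    · have h1 : 1 ≤ c n * ‖x‖ := by
        rwa [inv_le_iff_one_le_mul₀' (hc0 n)] at hx
      rw [iteratedFDeriv_sub_apply ((hPd n).contDiffAt.of_le (mod_cast le_top))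
        ((φ.smooth ⊤).contDiffAt.of_le (mod_cast le_top))]
      have h2 := norm_iteratedFDeriv_mul_le (hcd n) (φ.smooth ⊤) x (n := N) (mod_cast le_top)
      have h3 : ∀ j, ‖x‖ ^ k * ‖iteratedFDeriv ℝ j φ x‖ ≤
          c n * SchwartzMap.seminorm ℂ (k + 1) j φ := fun j => by
        calc ‖x‖ ^ k * ‖iteratedFDeriv ℝ j φ x‖
            ≤ (c n * ‖x‖) * (‖x‖ ^ k * ‖iteratedFDeriv ℝ j φ x‖) :=
              le_mul_of_one_le_left (by positivity) h1
          _ = c n * (‖x‖ ^ (k + 1) * ‖iteratedFDeriv ℝ j φ x‖) := by ring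
          _ ≤ _ := mul_le_mul_of_nonneg_left (SchwartzMap.le_seminorm ℂ (k + 1) j φ x) (hc0 n).le
      calc _ ≤ ‖x‖ ^ k * (∑ i ∈ Finset.range (N + 1), (N.choose i : ℝ) * M i *
              ‖iteratedFDeriv ℝ (N - i) φ x‖ + ‖iteratedFDeriv ℝ N φ x‖) := by
            gcongr
            refine (norm_sub_le _ _).trans ?_
            gcongr
            refine h2.trans ?_
            gcongr with i hi
            exact hM i _ (hc1 n) x
        _ = ∑ i ∈ Finset.range (N + 1), (N.choose i : ℝ) * M i *
              (‖x‖ ^ k * ‖iteratedFDeriv ℝ (N - i) φ x‖) +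
              ‖x‖ ^ k * ‖iteratedFDeriv ℝ N φ x‖ := by
            rw [mul_add, Finset.mul_sum]
            congr 1
            exact Finset.sum_congr rfl fun i _ => by ring
        _ ≤ ∑ i ∈ Finset.range (N + 1), (N.choose i : ℝ) * M i *
              (c n * SchwartzMap.seminorm ℂ (k + 1) (N - i) φ) +
              c n * SchwartzMap.seminorm ℂ (k + 1) N φ :=
            add_le_add (Finset.sum_le_sum fun i _ => mul_le_mul_of_nonneg_left (h3 _)
              (mul_nonneg (Nat.cast_nonneg _) (hM0 i))) (h3 _)
        _ = c n * B := by
            rw [mul_add, Finset.mul_sum]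
            congr 1
            exact Finset.sum_congr rfl fun i _ => by ring
  have hlim : Tendsto (fun n => c n * B) atTop (𝓝 0) := by
    have : Tendsto c atTop (𝓝 0) := by
      simpa [c, one_div] using tendsto_one_div_add_atTop_nhds_zero_nat (𝕜 := ℝ)
    simpa using this.mul_const B
  filter_upwards [hlim.eventually_lt_const hε] with n hn
  exact (key n).trans_lt hn

variable {d : ℕ}

/-- A tempered distribution is determined by its values on compactly supported functions. -/
theorem ext_of_hasCompactSupport {f g : 𝓢'(Space d, ℂ)}
    (h : ∀ φ : 𝓢(Space d, ℂ), HasCompactSupport (φ : Space d → ℂ) → f φ = g φ) : f = g := by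
  ext φ
  obtain ⟨ψ, hψ, hlim⟩ := exists_tendsto_hasCompactSupport φ
  have h1 := ((map_continuous f).tendsto φ).comp hlim
  have h2 := ((map_continuous g).tendsto φ).comp hlim
  refine tendsto_nhds_unique h1 (h2.congr fun n => ?_)
  exact (h _ (hψ n)).symm

theorem IsGivenBy.ext {f g : 𝓢'(Space d, ℂ)} {u : Space d → ℂ}
    (hf : IsGivenBy f u) (hg : IsGivenBy g u) : f = g :=
  ext_of_hasCompactSupport fun φ hφ => (hf.2 φ hφ).trans (hg.2 φ hφ).symm

theorem IsGivenBy.congr {f : 𝓢'(Space d, ℂ)} {u v : Space d → ℂ}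
    (hf : IsGivenBy f u) (h : u =ᵐ[volume] v) : IsGivenBy f v :=
  ⟨hf.1.congr h, fun φ hφ => (hf.2 φ hφ).trans
    (integral_congr_ae (h.mono fun x hx => by simp only [hx]))⟩

/-! ### Products as convolutions on the Fourier side -/

section

variable {d : ℕ}

/-- Self-adjointness of the Fourier transform on L¹, carried over to the inverse transform by
reflecting `w` and the integration variable. -/
theorem integral_fourierInv_mul_eq {φ w : Space d → ℂ} (hφ : Integrable φ) (hw : Integrable w) :
    ∫ ξ, 𝓕⁻ φ ξ * w ξ = ∫ x, φ x * 𝓕⁻ w x := by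
  have h := VectorFourier.integral_fourierIntegral_smul_eq_flip (L := innerₗ (Space d))
    (μ := volume) (ν := volume) Real.continuous_fourierChar continuous_inner hφ hw.comp_neg
  have h2 : ∀ g : Space d → ℂ, VectorFourier.fourierIntegral Real.fourierChar volume
      (innerₗ (Space d)) g = 𝓕 g := fun g => rfl
  rw [flip_innerₗ] at h
  simp only [h2, smul_eq_mul] at h
  rw [← integral_neg_eq_self]
  simp only [Real.fourierInv_eq_fourier_neg, neg_neg]
  rw [h]
  refine integral_congr_ae (Eventually.of_forall fun x => ?_)
  simp only [← Real.fourierInv_eq_fourier_neg, Real.fourierInv_eq_fourier_comp_neg w]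

theorem continuous_fourierInv {w : Space d → ℂ} (hw : Integrable w) : Continuous (𝓕⁻ w) := by
  rw [Real.fourierInv_eq_fourier_comp_neg]
  exact VectorFourier.fourierIntegral_continuous (L := innerₗ (Space d))
    Real.continuous_fourierChar continuous_inner hw.comp_neg

/-- An integrable density itself defines a tempered distribution. It agrees with `f` on compactly
supported test functions, hence everywhere by density. -/
theorem IsGivenBy.apply_eq {f : 𝓢'(Space d, ℂ)} {w : Space d → ℂ} (h : IsGivenBy f w)
    (hw : Integrable w) (φ : 𝓢(Space d, ℂ)) : f φ = ∫ x, φ x * w x := by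
  have key : ∀ φ : 𝓢(Space d, ℂ),
      Lp.toTemperedDistribution (memLp_one_iff_integrable.2 hw).toLp φ = ∫ x, φ x * w x := by
    intro φ
    rw [Lp.toTemperedDistribution_apply]
    refine integral_congr_ae ?_
    filter_upwards [(memLp_one_iff_integrable.2 hw).coeFn_toLp] with x hx
    rw [hx, smul_eq_mul]
  rw [← key, h.ext ⟨h.1, fun φ _ => key φ⟩]

theorem exists_isGivenBy {w : Space d → ℂ} (hw : Integrable w) :
    ∃ f : 𝓢'(Space d, ℂ), IsGivenBy f w := by
  refine ⟨Lp.toTemperedDistribution (memLp_one_iff_integrable.2 hw).toLp,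
    hw.locallyIntegrable, fun φ _ => ?_⟩
  rw [Lp.toTemperedDistribution_apply]
  refine integral_congr_ae ?_
  filter_upwards [(memLp_one_iff_integrable.2 hw).coeFn_toLp] with x hx
  rw [hx, smul_eq_mul]

/-- A distribution with integrable Fourier transform is the inverse Fourier integral of the
latter. -/
theorem apply_eq_of_fourier {f : 𝓢'(Space d, ℂ)} {w : Space d → ℂ}
    (h : IsGivenBy (𝓕 f) w) (hw : Integrable w) (φ : 𝓢(Space d, ℂ)) :
    f φ = ∫ x, φ x * 𝓕⁻ w x := by
  have h1 : f φ = 𝓕 f (𝓕⁻ φ) := by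
    rw [TemperedDistribution.fourier_apply, FourierTransform.fourier_fourierInv_eq]
  rw [h1, h.apply_eq hw, ← integral_fourierInv_mul_eq φ.integrable hw, SchwartzMap.fourierInv_coe]

theorem isGivenBy_of_fourier {f : 𝓢'(Space d, ℂ)} {w : Space d → ℂ}
    (h : IsGivenBy (𝓕 f) w) (hw : Integrable w) : IsGivenBy f (𝓕⁻ w) :=
  ⟨(continuous_fourierInv hw).locallyIntegrable, fun φ _ => apply_eq_of_fourier h hw φ⟩

theorem exists_fourier_isGivenBy {w : Space d → ℂ} (hw : Integrable w) :
    ∃ f : 𝓢'(Space d, ℂ), IsGivenBy (𝓕 f) w := by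
  obtain ⟨g, hg⟩ := exists_isGivenBy hw
  exact ⟨𝓕⁻ g, by rwa [FourierTransform.fourier_fourierInv_eq]⟩

/-- The convolution of two functions. -/
def conv (F G : Space d → ℂ) (ξ : Space d) : ℂ := ∫ η, F η * G (ξ - η)

theorem integrable_conv {F G : Space d → ℂ} (hF : Integrable F) (hG : Integrable G) :
    Integrable (conv F G) :=
  hF.integrable_convolution (ContinuousLinearMap.mul ℂ ℂ) hG

theorem fourierInv_conv {F G : Space d → ℂ} (hF : Integrable F) (hG : Integrable G)
    (x : Space d) : 𝓕⁻ (conv F G) x = 𝓕⁻ F x * 𝓕⁻ G x := by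
  simp only [Real.fourierInv_eq_fourier_neg]
  exact Real.fourier_mul_convolution_eq hF hG (-x)

theorem ae_im_eq_zero {f : 𝓢'(Space d, ℂ)} (hf : f ∈ realDistributions d) {u : Space d → ℂ}
    (hu : IsGivenBy f u) : ∀ᵐ x, (u x).im = 0 := by
  have hloc : LocallyIntegrable (fun x => (u x).im) volume := fun x => by
    obtain ⟨s, hs, hi⟩ := hu.1 x
    exact ⟨s, hs, Complex.imCLM.integrable_comp hi⟩
  refine ae_eq_zero_of_integral_contDiff_smul_eq_zero hloc fun g g_smooth g_cpt => ?_
  have hg₁ : HasCompactSupport (Complex.ofRealCLM ∘ g) := g_cpt.comp_left rfl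
  have hg₂ : ContDiff ℝ ∞ (Complex.ofRealCLM ∘ g) := by fun_prop
  let φ : 𝓢(Space d, ℂ) := hg₁.toSchwartzMap hg₂
  have hφ : ∀ x, φ x = (g x : ℂ) := fun x => rfl
  have h0 : (f φ).im = 0 := hf φ fun x => by rw [hφ, Complex.ofReal_im]
  have hint : Integrable (fun x => φ x * u x) := hu.integrable_mul hg₁
  rw [hu.2 φ hg₁] at h0
  have h1 := Complex.imCLM.integral_comp_comm hint
  rw [Complex.imCLM_apply, h0] at h1
  rw [← h1]
  refine integral_congr_ae (Eventually.of_forall fun x => ?_)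
  simp [hφ]

theorem mem_realDistributions {f : 𝓢'(Space d, ℂ)} {u : Space d → ℂ}
    (hf : ∀ φ : 𝓢(Space d, ℂ), f φ = ∫ x, φ x * u x) (hu : ∀ᵐ x, (u x).im = 0) :
    f ∈ realDistributions d := by
  intro φ hφ
  have h : ∫ x, φ x * u x = ∫ x, (((φ x * u x).re : ℝ) : ℂ) := by
    refine integral_congr_ae ?_
    filter_upwards [hu] with x hx
    apply Complex.ext <;> simp [hφ x, hx]
  rw [hf, h, integral_complex_ofReal, Complex.ofReal_im]

/-- The convolution theorem for integrable functions. Realness passes to the product because both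
factors are real almost everywhere, so one argument serves both scalar fields. -/
theorem exists_mul {f g : 𝓢'(Space d, ℂ)} {F G : Space d → ℂ} (hf : IsGivenBy (𝓕 f) F)
    (hg : IsGivenBy (𝓕 g) G) (hF : Integrable F) (hG : Integrable G) :
    ∃ h : 𝓢'(Space d, ℂ), IsGivenBy (𝓕 h) (conv F G) ∧ IsPointwiseProduct f g h ∧
      (f ∈ realDistributions d → g ∈ realDistributions d → h ∈ realDistributions d) := by
  obtain ⟨h, hh⟩ := exists_fourier_isGivenBy (integrable_conv hF hG)
  have hf' := isGivenBy_of_fourier hf hF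
  have hg' := isGivenBy_of_fourier hg hG
  have hh' := isGivenBy_of_fourier hh (integrable_conv hF hG)
  have hmul : 𝓕⁻ (conv F G) = fun x => 𝓕⁻ F x * 𝓕⁻ G x := funext (fourierInv_conv hF hG)
  refine ⟨h, hh, ⟨_, _, hf', hg', hmul ▸ hh'⟩, fun hfr hgr => ?_⟩
  refine mem_realDistributions (apply_eq_of_fourier hh (integrable_conv hF hG)) ?_
  filter_upwards [ae_im_eq_zero hfr hf', ae_im_eq_zero hgr hg'] with x hx hy
  simp [fourierInv_conv hF hG, hx, hy]

theorem BoundedMul.closedUnderMul {V : Set 𝓢'(Space d, ℂ)} {N : 𝓢'(Space d, ℂ) → ℝ}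
    (h : BoundedMul V N) : ClosedUnderMul V := by
  obtain ⟨C, -, hC⟩ := h
  intro f hf g hg
  obtain ⟨h, h1, h2, -⟩ := hC f hf g hg
  exact ⟨h, h1, h2⟩

/-- Conjugating the integral and substituting -ξ for ξ gives it back. -/
theorem fourierInv_im_eq_zero {F : Space d → ℂ} (hF : ∀ ξ, F (-ξ) = (starRingEnd ℂ) (F ξ))
    (x : Space d) : (𝓕⁻ F x).im = 0 := by
  rw [← Complex.conj_eq_iff_im, Real.fourierInv_eq, ← integral_conj, ← integral_neg_eq_self]
  refine integral_congr_ae (Eventually.of_forall fun ξ => ?_)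
  simp only [hF, Circle.smul_def, smul_eq_mul, map_mul, inner_neg_left, Complex.conj_conj,
    AddChar.map_neg_eq_inv, Circle.coe_inv_eq_conj]

section algebra

variable [NeZero d] {s r δ : ℝ}

theorem boundedMul_of_energy_conv_le {C : ℝ≥0∞} (hC : C ≠ ⊤)
    (hint : ∀ w : Space d → ℂ, AEStronglyMeasurable w → energy s r δ w < ⊤ → Integrable w)
    (hconv : ∀ F G : Space d → ℂ, Integrable F → Integrable G →
      energy s r δ (conv F G) ≤ C * energy s r δ F * energy s r δ G) :
    BoundedMul (d := d) (X d s r δ) (xNorm s r δ) ∧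
      BoundedMul (d := d) (XReal d s r δ) (xNorm s r δ) := by
  -- The energy is the square of the norm, whence the square root; adding 1 keeps the constant
  -- positive even if `C` is 0.
  have key : ∀ f ∈ X d s r δ, ∀ g ∈ X d s r δ, ∃ h ∈ X d s r δ, IsPointwiseProduct f g h ∧
      xNorm s r δ h ≤ (√C.toReal + 1) * xNorm s r δ f * xNorm s r δ g ∧
      (f ∈ realDistributions d → g ∈ realDistributions d → h ∈ realDistributions d) := by
    rintro f ⟨F, hF, hFe⟩ g ⟨G, hG, hGe⟩
    have hFi := hint F hF.1.aestronglyMeasurable hFe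
    have hGi := hint G hG.1.aestronglyMeasurable hGe
    obtain ⟨h, hh, hp, hr⟩ := exists_mul hF hG hFi hGi
    have hle := hconv F G hFi hGi
    have hfin : C * energy s r δ F * energy s r δ G < ⊤ :=
      ENNReal.mul_lt_top (ENNReal.mul_lt_top hC.lt_top hFe) hGe
    refine ⟨h, ⟨_, hh, hle.trans_lt hfin⟩, hp, ?_, hr⟩
    rw [xNorm_eq s r δ hh, xNorm_eq s r δ hF, xNorm_eq s r δ hG]
    have h1 : (energy s r δ (conv F G)).toReal ≤
        C.toReal * (energy s r δ F).toReal * (energy s r δ G).toReal := by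
      rw [← ENNReal.toReal_mul, ← ENNReal.toReal_mul]
      exact ENNReal.toReal_mono hfin.ne hle
    refine (Real.sqrt_le_sqrt h1).trans ?_
    rw [Real.sqrt_mul (by positivity), Real.sqrt_mul (by positivity)]
    gcongr
    linarith
  refine ⟨⟨√C.toReal + 1, by positivity, fun f hf g hg => ?_⟩,
    ⟨√C.toReal + 1, by positivity, fun f hf g hg => ?_⟩⟩
  · obtain ⟨h, h1, h2, h3, -⟩ := key f hf g hg
    exact ⟨h, h1, h2, h3⟩
  · obtain ⟨h, h1, h2, h3, h4⟩ := key f hf.1 g hg.1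
    exact ⟨h, ⟨h1, h4 hf.2 hg.2⟩, h2, h3⟩

/-- If the square of a function with Fourier transform `F` is in the space, then the
convolution square of `F` has finite energy. -/
theorem energy_conv_lt_top {f h : 𝓢'(Space d, ℂ)} {F : Space d → ℂ} (hf : IsGivenBy (𝓕 f) F)
    (hF : Integrable F) (hh : h ∈ X d s r δ) (hp : IsPointwiseProduct f f h) :
    energy s r δ (conv F F) < ⊤ := by
  obtain ⟨h', hh', ⟨u', v', hu', hv', huv'⟩, -⟩ := exists_mul hf hf hF hF
  obtain ⟨u, v, hu, hv, huv⟩ := hp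
  have heq : h = h' := huv.ext (huv'.congr (by
    filter_upwards [hu.ae_eq hu', hv.ae_eq hv'] with x h1 h2
    rw [h1, h2]))
  obtain ⟨w, hw, hwe⟩ := hh
  subst heq
  rwa [energy_congr s r δ (hh'.ae_eq hw)]

/-- The square of one function refutes both cases: the symmetry of `F` makes that function
real-valued, and a product is determined by its factors, so its transform can only be `conv F F`. -/
theorem not_closedUnderMul {F : Space d → ℂ} (hF : Integrable F) (hFe : energy s r δ F < ⊤)
    (hsymm : ∀ ξ, F (-ξ) = (starRingEnd ℂ) (F ξ)) (hconv : energy s r δ (conv F F) = ⊤) :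
    ¬ ClosedUnderMul (d := d) (X d s r δ) ∧ ¬ ClosedUnderMul (d := d) (XReal d s r δ) := by
  obtain ⟨f, hf⟩ := exists_fourier_isGivenBy hF
  have hfX : f ∈ X d s r δ := ⟨F, hf, hFe⟩
  have hfR : f ∈ realDistributions d := mem_realDistributions (apply_eq_of_fourier hf hF)
    (Eventually.of_forall (fourierInv_im_eq_zero hsymm))
  refine ⟨fun h => ?_, fun h => ?_⟩
  · obtain ⟨g, hg, hp⟩ := h f hfX f hfX
    exact (energy_conv_lt_top hf hF hg hp).ne hconv
  · obtain ⟨g, hg, hp⟩ := h f ⟨hfX, hfR⟩ f ⟨hfX, hfR⟩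
    exact (energy_conv_lt_top hf hF hg.1 hp).ne hconv

end algebra

end

/-! ### A bilinear estimate of Schur type -/

/-- Cauchy–Schwarz, with the square root taken of the whole product so that the factors under it can
be regrouped at will. -/
theorem sq_lintegral_rpow_half_le {α : Type*} [MeasurableSpace α] {μ : Measure α}
    {f g : α → ℝ≥0∞} (hf : AEMeasurable f μ) (hg : AEMeasurable g μ) :
    (∫⁻ x, (f x * g x) ^ (1 / 2 : ℝ) ∂μ) ^ 2 ≤ (∫⁻ x, f x ∂μ) * ∫⁻ x, g x ∂μ := by
  have h := ENNReal.lintegral_mul_norm_pow_le hf hg (p := 1 / 2) (q := 1 / 2)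
    (by norm_num) (by norm_num) (by norm_num)
  have h1 : ∀ x, (f x * g x) ^ (1 / 2 : ℝ) = f x ^ (1 / 2 : ℝ) * g x ^ (1 / 2 : ℝ) := fun x =>
    ENNReal.mul_rpow_of_nonneg _ _ (by norm_num)
  simp only [h1]
  refine (pow_le_pow_left' h 2).trans (le_of_eq ?_)
  rw [← ENNReal.mul_rpow_of_nonneg _ _ (by norm_num), ← ENNReal.rpow_natCast,
    ← ENNReal.rpow_mul]
  norm_num

theorem sq_add_three_le (a b c : ℝ≥0∞) : (a + b + c) ^ 2 ≤ 3 * (a ^ 2 + b ^ 2 + c ^ 2) := by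
  by_cases h : a = ⊤ ∨ b = ⊤ ∨ c = ⊤
  · rcases h with h | h | h <;> simp [h]
  · push Not at h
    lift a to NNReal using h.1
    lift b to NNReal using h.2.1
    lift c to NNReal using h.2.2
    norm_cast
    rw [← NNReal.coe_le_coe]
    push_cast
    nlinarith [sq_nonneg ((a : ℝ) - b), sq_nonneg ((a : ℝ) - c), sq_nonneg ((b : ℝ) - c)]

/-- A bilinear convolution estimate in weighted `L²` from Schur-type bounds on the quotient
`W (η + ζ) / (W η * W ζ)`. -/
theorem lintegral_conv_sq_le {d : ℕ} [NeZero d] {W : Space d → ℝ≥0∞} (hW : Measurable W)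
    {K₁ K₂ K₃ : Space d → Space d → ℝ≥0∞} (m₁ : Measurable (Function.uncurry K₁))
    (m₂ : Measurable (Function.uncurry K₂)) (m₃ : Measurable (Function.uncurry K₃)) {C : ℝ≥0∞}
    (h₁ : ∀ ζ, ∫⁻ η, K₁ η ζ ≤ C) (h₂ : ∀ η, ∫⁻ ζ, K₂ η ζ ≤ C)
    (h₃ : ∀ ξ, ∫⁻ η, K₃ η (ξ - η) ≤ C)
    (hK : ∀ η ζ, η ≠ 0 → ζ ≠ 0 → W (η + ζ) ≤ W η * W ζ * (K₁ η ζ + K₂ η ζ + K₃ η ζ))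
    {F G : Space d → ℝ≥0∞} (hF : Measurable F) (hG : Measurable G) :
    ∫⁻ ξ, W ξ * (∫⁻ η, F η * G (ξ - η)) ^ 2 ≤
      9 * C * (∫⁻ η, W η * F η ^ 2) * ∫⁻ ζ, W ζ * G ζ ^ 2 := by
  set A : Space d → ℝ≥0∞ := fun η => W η * F η ^ 2 with hA
  set B : Space d → ℝ≥0∞ := fun η => W η * G η ^ 2 with hB
  have mA : Measurable A := hW.mul (hF.pow_const 2)
  have mB : Measurable B := hW.mul (hG.pow_const 2)
  let J : (Space d → Space d → ℝ≥0∞) → Space d → ℝ≥0∞ := fun K ξ =>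
    ∫⁻ η, (K η (ξ - η) * (A η * B (ξ - η))) ^ (1 / 2 : ℝ)
  have msub : Measurable fun p : Space d × Space d => (p.2, p.1 - p.2) := by fun_prop
  have mK : ∀ {K : Space d → Space d → ℝ≥0∞}, Measurable (Function.uncurry K) →
      Measurable fun p : Space d × Space d => K p.2 (p.1 - p.2) := fun hm => hm.comp msub
  have mK' : ∀ {K : Space d → Space d → ℝ≥0∞}, Measurable (Function.uncurry K) → ∀ ξ,
      Measurable fun η => K η (ξ - η) := fun hm ξ =>
    hm.comp (by fun_prop : Measurable fun η : Space d => (η, ξ - η))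
  have mBs : ∀ ξ, Measurable fun η => B (ξ - η) := fun ξ => mB.comp (by fun_prop)
  have mJi : ∀ {K : Space d → Space d → ℝ≥0∞}, Measurable (Function.uncurry K) →
      Measurable fun p : Space d × Space d =>
        (K p.2 (p.1 - p.2) * (A p.2 * B (p.1 - p.2))) ^ (1 / 2 : ℝ) := fun hm =>
    ((mK hm).mul ((mA.comp measurable_snd).mul
      (mB.comp (measurable_fst.sub measurable_snd)))).pow_const _
  have mJ : ∀ {K : Space d → Space d → ℝ≥0∞}, Measurable (Function.uncurry K) →
      Measurable (J K) := fun hm => (mJi hm).lintegral_prod_right'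
  have mJ' : ∀ {K : Space d → Space d → ℝ≥0∞}, Measurable (Function.uncurry K) → ∀ ξ,
      Measurable fun η => (K η (ξ - η) * (A η * B (ξ - η))) ^ (1 / 2 : ℝ) := fun hm ξ =>
    (mJi hm).comp (by fun_prop : Measurable fun η : Space d => (ξ, η))
  -- The root of `W ξ` goes inside the integral; subadditivity of the square root then separates the
  -- three kernels.
  have hpt : ∀ ξ, W ξ * (∫⁻ η, F η * G (ξ - η)) ^ 2 ≤
      3 * (J K₁ ξ ^ 2 + J K₂ ξ ^ 2 + J K₃ ξ ^ 2) := by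
    intro ξ
    have h0 : W ξ ^ (1 / 2 : ℝ) * ∫⁻ η, F η * G (ξ - η) ≤ J K₁ ξ + J K₂ ξ + J K₃ ξ := by
      have mFG : Measurable fun η => F η * G (ξ - η) := hF.mul (hG.comp (by fun_prop))
      rw [← lintegral_const_mul _ mFG, ← lintegral_add_left (mJ' m₁ ξ),
        ← lintegral_add_left (μ := volume) (f := fun η =>
          (K₁ η (ξ - η) * (A η * B (ξ - η))) ^ (1 / 2 : ℝ) +
          (K₂ η (ξ - η) * (A η * B (ξ - η))) ^ (1 / 2 : ℝ)) ((mJ' m₁ ξ).add (mJ' m₂ ξ))]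
      have hne : ∀ᵐ η : Space d, η ≠ 0 ∧ η ≠ ξ :=
        (Measure.ae_ne volume 0).and (Measure.ae_ne volume ξ)
      refine lintegral_mono_ae ?_
      filter_upwards [hne] with η hη
      have h1 := hK η (ξ - η) hη.1 (sub_ne_zero.2 hη.2.symm)
      rw [add_sub_cancel] at h1
      have h2 : W ξ ^ (1 / 2 : ℝ) * (F η * G (ξ - η)) =
          (W ξ * (F η * G (ξ - η)) ^ 2) ^ (1 / 2 : ℝ) := by
        rw [ENNReal.mul_rpow_of_nonneg _ _ (by norm_num), ← ENNReal.rpow_natCast,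
          ← ENNReal.rpow_mul]
        norm_num
      rw [h2]
      have h3 : W ξ * (F η * G (ξ - η)) ^ 2 ≤ K₁ η (ξ - η) * (A η * B (ξ - η)) +
          K₂ η (ξ - η) * (A η * B (ξ - η)) + K₃ η (ξ - η) * (A η * B (ξ - η)) := by
        calc _ ≤ W η * W (ξ - η) * (K₁ η (ξ - η) + K₂ η (ξ - η) + K₃ η (ξ - η)) *
              (F η * G (ξ - η)) ^ 2 := by gcongr
          _ = _ := by simp only [hA, hB]; ring
      refine (ENNReal.rpow_le_rpow h3 (by norm_num)).trans ?_
      refine (ENNReal.rpow_add_le_add_rpow _ _ (by norm_num) (by norm_num)).trans ?_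
      gcongr
      exact ENNReal.rpow_add_le_add_rpow _ _ (by norm_num) (by norm_num)
    calc W ξ * (∫⁻ η, F η * G (ξ - η)) ^ 2
        = (W ξ ^ (1 / 2 : ℝ) * ∫⁻ η, F η * G (ξ - η)) ^ 2 := by
          rw [mul_pow, ← ENNReal.rpow_natCast (W ξ ^ (1 / 2 : ℝ)), ← ENNReal.rpow_mul]
          norm_num
      _ ≤ (J K₁ ξ + J K₂ ξ + J K₃ ξ) ^ 2 := pow_le_pow_left' h0 2
      _ ≤ _ := sq_add_three_le _ _ _
  have hshift : ∀ (K : Space d → Space d → ℝ≥0∞), Measurable (Function.uncurry K) →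
      ∫⁻ ξ, ∫⁻ η, K η (ξ - η) = ∫⁻ η, ∫⁻ ζ, K η ζ := by
    intro K hm
    rw [lintegral_lintegral_swap (mK hm).aemeasurable]
    exact lintegral_congr fun η => lintegral_sub_right_eq_self (fun ζ => K η ζ) η
  -- The three kernels differ only in the grouping for Cauchy–Schwarz: `K₁` goes with `B`, `K₂` with
  -- `A`, and `K₃` stands alone, so that each is integrated in the variable where it is controlled.
  have hJ₁ : ∫⁻ ξ, J K₁ ξ ^ 2 ≤ C * (∫⁻ η, A η) * ∫⁻ ζ, B ζ := by
    have mm : Measurable (Function.uncurry fun η ζ => K₁ η ζ * B ζ) :=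
      m₁.mul (mB.comp measurable_snd)
    calc ∫⁻ ξ, J K₁ ξ ^ 2 ≤ ∫⁻ ξ, (∫⁻ η, A η) * ∫⁻ η, K₁ η (ξ - η) * B (ξ - η) := by
          refine lintegral_mono fun ξ => ?_
          refine le_trans (le_of_eq ?_) (sq_lintegral_rpow_half_le mA.aemeasurable
            ((mK' m₁ ξ).mul (mBs ξ)).aemeasurable)
          congr 1
          exact lintegral_congr fun η => by congr 1; ring
      _ = (∫⁻ η, A η) * ∫⁻ η, ∫⁻ ζ, K₁ η ζ * B ζ := by
          rw [lintegral_const_mul _ (mK mm).lintegral_prod_right', hshift _ mm]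
      _ = (∫⁻ η, A η) * ∫⁻ ζ, (∫⁻ η, K₁ η ζ) * B ζ := by
          rw [lintegral_lintegral_swap mm.aemeasurable]
          congr 1
          exact lintegral_congr fun ζ => lintegral_mul_const _
            (m₁.comp (by fun_prop : Measurable fun η : Space d => (η, ζ)))
      _ ≤ (∫⁻ η, A η) * ∫⁻ ζ, C * B ζ := by
          gcongr with ζ
          exact h₁ ζ
      _ = _ := by rw [lintegral_const_mul _ mB]; ring
  have hJ₂ : ∫⁻ ξ, J K₂ ξ ^ 2 ≤ C * (∫⁻ η, A η) * ∫⁻ ζ, B ζ := by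
    have mm : Measurable (Function.uncurry fun η ζ => A η * K₂ η ζ) :=
      (mA.comp measurable_fst).mul m₂
    calc ∫⁻ ξ, J K₂ ξ ^ 2 ≤ ∫⁻ ξ, (∫⁻ η, A η * K₂ η (ξ - η)) * ∫⁻ η, B η := by
          refine lintegral_mono fun ξ => ?_
          rw [← lintegral_sub_left_eq_self B ξ]
          refine le_trans (le_of_eq ?_) (sq_lintegral_rpow_half_le
            (mA.mul (mK' m₂ ξ)).aemeasurable (mBs ξ).aemeasurable)
          congr 1
          exact lintegral_congr fun η => by congr 1; ring
      _ = (∫⁻ η, ∫⁻ ζ, A η * K₂ η ζ) * ∫⁻ ζ, B ζ := by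
          rw [lintegral_mul_const _ (mK mm).lintegral_prod_right', hshift _ mm]
      _ = (∫⁻ η, A η * ∫⁻ ζ, K₂ η ζ) * ∫⁻ ζ, B ζ := by
          congr 1
          exact lintegral_congr fun η => lintegral_const_mul _
            (m₂.comp (by fun_prop : Measurable fun ζ : Space d => (η, ζ)))
      _ ≤ (∫⁻ η, A η * C) * ∫⁻ ζ, B ζ := by
          gcongr with η
          exact h₂ η
      _ = _ := by rw [lintegral_mul_const _ mA]; ring
  have hJ₃ : ∫⁻ ξ, J K₃ ξ ^ 2 ≤ C * (∫⁻ η, A η) * ∫⁻ ζ, B ζ := by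
    have mm : Measurable (Function.uncurry fun η ζ => A η * B ζ) :=
      (mA.comp measurable_fst).mul (mB.comp measurable_snd)
    calc ∫⁻ ξ, J K₃ ξ ^ 2 ≤ ∫⁻ ξ, C * ∫⁻ η, A η * B (ξ - η) := by
          refine lintegral_mono fun ξ => ?_
          refine (sq_lintegral_rpow_half_le (mK' m₃ ξ).aemeasurable
            (mA.mul (mBs ξ)).aemeasurable).trans ?_
          exact mul_le_mul_left (h₃ ξ) _
      _ = C * ∫⁻ η, ∫⁻ ζ, A η * B ζ := by
          rw [lintegral_const_mul _ (mK mm).lintegral_prod_right', hshift _ mm]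
      _ = C * ∫⁻ η, A η * ∫⁻ ζ, B ζ := by
          congr 1
          exact lintegral_congr fun η => lintegral_const_mul _ mB
      _ = _ := by rw [lintegral_mul_const _ mA]; ring
  calc ∫⁻ ξ, W ξ * (∫⁻ η, F η * G (ξ - η)) ^ 2
      ≤ ∫⁻ ξ, 3 * (J K₁ ξ ^ 2 + J K₂ ξ ^ 2 + J K₃ ξ ^ 2) := lintegral_mono hpt
    _ = 3 * ((∫⁻ ξ, J K₁ ξ ^ 2) + (∫⁻ ξ, J K₂ ξ ^ 2) + ∫⁻ ξ, J K₃ ξ ^ 2) := by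
        have q₁ := (mJ m₁).pow_const 2
        have q₂ := (mJ m₂).pow_const 2
        have q₃ := (mJ m₃).pow_const 2
        rw [lintegral_const_mul' _ _ (by norm_num), lintegral_add_right _ q₃,
          lintegral_add_right _ q₂]
    _ ≤ 3 * (C * (∫⁻ η, A η) * (∫⁻ ζ, B ζ) + C * (∫⁻ η, A η) * (∫⁻ ζ, B ζ) +
          C * (∫⁻ η, A η) * (∫⁻ ζ, B ζ)) := by gcongr
    _ = _ := by ring

/-! ### Model integrals and bounds on slices -/

theorem lintegral_eq_mul_lintegral_smul {E : Type*} [NormedAddCommGroup E] [NormedSpace ℝ E]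
    [FiniteDimensional ℝ E] [MeasurableSpace E] [BorelSpace E] (μ : Measure E)
    [μ.IsAddHaarMeasure] {R : ℝ} (hR : 0 < R) {f : E → ℝ≥0∞} (hf : Measurable f) :
    ∫⁻ y, f y ∂μ = ENNReal.ofReal (R ^ Module.finrank ℝ E) * ∫⁻ z, f (R • z) ∂μ := by
  have h := Measure.map_addHaar_smul μ hR.ne'
  have h1 : ∫⁻ z, f (R • z) ∂μ =
      ENNReal.ofReal |(R ^ Module.finrank ℝ E)⁻¹| * ∫⁻ y, f y ∂μ := by
    rw [← lintegral_map hf (measurable_const_smul R), h, lintegral_smul_measure, smul_eq_mul]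
  rw [h1, ← mul_assoc, ← ENNReal.ofReal_mul (by positivity), abs_of_pos (by positivity),
    mul_inv_cancel₀ (by positivity), ENNReal.ofReal_one, one_mul]

theorem exists_lintegral_norm_rpow_le {E : Type*} [NormedAddCommGroup E] [NormedSpace ℝ E]
    [FiniteDimensional ℝ E] [MeasurableSpace E] [BorelSpace E] (μ : Measure E)
    [μ.IsAddHaarMeasure] {b : ℝ} (hE : 0 < Module.finrank ℝ E)
    (hb : b < Module.finrank ℝ E) :
    ∃ C : ℝ≥0∞, C ≠ ⊤ ∧ ∀ R : ℝ, 0 < R →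
      ∫⁻ y, (closedBall (0 : E) R).indicator (fun y => ENNReal.ofReal (‖y‖ ^ (-b))) y ∂μ ≤
        C * ENNReal.ofReal (R ^ (Module.finrank ℝ E - b)) := by
  have hm : Measurable fun y : E => ‖y‖ ^ (-b) := measurable_norm.pow_const _
  have hi : IntegrableOn (fun y : E => ‖y‖ ^ (-b)) (ball 0 2) μ :=
    integrableOn_ball_of_norm_le_rpow (C := 1) hE hb
      (Eventually.of_forall fun y => by
        rw [Real.norm_of_nonneg (by positivity), one_mul]) hm.aestronglyMeasurable
  -- Scaling by `R` reduces to the closed unit ball, which lies in the open ball of radius 2.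
  refine ⟨∫⁻ y in ball (0 : E) 2, ENNReal.ofReal (‖y‖ ^ (-b)) ∂μ, ?_, fun R hR => ?_⟩
  · have := hi.2
    rw [hasFiniteIntegral_iff_ofReal (Eventually.of_forall fun y => by positivity)] at this
    exact this.ne
  · rw [lintegral_eq_mul_lintegral_smul μ hR (hm.ennreal_ofReal.indicator
      measurableSet_closedBall), mul_comm, ← lintegral_indicator measurableSet_ball]
    have hpt : ∀ z : E, (closedBall (0 : E) R).indicator
        (fun y => ENNReal.ofReal (‖y‖ ^ (-b))) (R • z) ≤
        (ball (0 : E) 2).indicator (fun y => ENNReal.ofReal (‖y‖ ^ (-b))) z *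
          ENNReal.ofReal (R ^ (-b)) := by
      intro z
      by_cases hz : R • z ∈ closedBall (0 : E) R
      · have hz' : z ∈ ball (0 : E) 2 := by
          rw [mem_closedBall_zero_iff, norm_smul, Real.norm_of_nonneg hR.le] at hz
          rw [mem_ball_zero_iff]
          have := (mul_le_iff_le_one_right hR).1 hz
          linarith
        rw [Set.indicator_of_mem hz, Set.indicator_of_mem hz', norm_smul,
          Real.norm_of_nonneg hR.le, Real.mul_rpow hR.le (norm_nonneg _),
          ENNReal.ofReal_mul (by positivity), mul_comm]
      · rw [Set.indicator_of_notMem hz]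
        exact zero_le
    calc _ ≤ (∫⁻ z, (ball (0 : E) 2).indicator (fun y => ENNReal.ofReal (‖y‖ ^ (-b))) z *
          ENNReal.ofReal (R ^ (-b)) ∂μ) * ENNReal.ofReal (R ^ Module.finrank ℝ E) := by
          gcongr with z
          exact hpt z
      _ = _ := by
          rw [lintegral_mul_const _ (hm.ennreal_ofReal.indicator measurableSet_ball), mul_assoc,
            ← ENNReal.ofReal_mul (by positivity), ← Real.rpow_natCast, ← Real.rpow_add hR]
          congr 3
          ring

/-- Translation and scaling reduce to c = 0 and A = 1. Uniformity in `c` is essential: it will be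
the first coordinate of the frequency held fixed. -/
theorem exists_lintegral_cauchy_le :
    ∃ C : ℝ≥0∞, C ≠ ⊤ ∧ ∀ A c : ℝ, 0 < A →
      ∫⁻ t : ℝ, ENNReal.ofReal (1 / ((t - c) ^ 2 + A ^ 2)) ≤ C * ENNReal.ofReal (1 / A) := by
  refine ⟨∫⁻ t : ℝ, ENNReal.ofReal ((1 + t ^ 2)⁻¹), ?_, fun A c hA => ?_⟩
  · have := integrable_inv_one_add_sq.2
    rw [hasFiniteIntegral_iff_ofReal (Eventually.of_forall fun y => by positivity)] at this
    exact this.ne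
  · rw [lintegral_sub_right_eq_self (fun t : ℝ => ENNReal.ofReal (1 / (t ^ 2 + A ^ 2))) c,
      lintegral_eq_mul_lintegral_smul volume hA (by fun_prop), Module.finrank_self, pow_one,
      ← lintegral_const_mul _ (by fun_prop), ← lintegral_mul_const _ (by fun_prop)]
    refine lintegral_mono fun z => ?_
    rw [← ENNReal.ofReal_mul hA.le, ← ENNReal.ofReal_mul (by positivity), smul_eq_mul]
    refine ENNReal.ofReal_le_ofReal (le_of_eq ?_)
    field_simp
    ring

theorem exists_lintegral_japanese_le {E : Type*} [NormedAddCommGroup E] [NormedSpace ℝ E]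
    [FiniteDimensional ℝ E] [MeasurableSpace E] [BorelSpace E] (μ : Measure E)
    [μ.IsAddHaarMeasure] {ρ : ℝ} (hρ : (Module.finrank ℝ E : ℝ) < 2 * ρ) :
    ∃ C : ℝ≥0∞, C ≠ ⊤ ∧ ∀ t : ℝ, t ≠ 0 →
      ∫⁻ y : E, ENNReal.ofReal ((t ^ 2 + ‖y‖ ^ 2) ^ (-ρ)) ∂μ ≤
        C * ENNReal.ofReal (|t| ^ (Module.finrank ℝ E - 2 * ρ)) := by
  refine ⟨∫⁻ y : E, ENNReal.ofReal ((1 + ‖y‖ ^ 2) ^ (-(2 * ρ) / 2)) ∂μ, ?_, fun t ht => ?_⟩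
  · have := (integrable_rpow_neg_one_add_norm_sq (μ := μ) hρ).2
    rw [hasFiniteIntegral_iff_ofReal (Eventually.of_forall fun y => by positivity)] at this
    exact this.ne
  · have ht' : 0 < |t| := abs_pos.2 ht
    have m1 : Measurable fun y : E => ENNReal.ofReal ((t ^ 2 + ‖y‖ ^ 2) ^ (-ρ)) := by fun_prop
    have m2 : Measurable fun y : E => ENNReal.ofReal ((t ^ 2 + ‖|t| • y‖ ^ 2) ^ (-ρ)) := by
      fun_prop
    have m3 : Measurable fun y : E => ENNReal.ofReal ((1 + ‖y‖ ^ 2) ^ (-(2 * ρ) / 2)) := by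
      fun_prop
    rw [lintegral_eq_mul_lintegral_smul μ ht' m1, ← lintegral_const_mul _ m2,
      ← lintegral_mul_const _ m3]
    refine lintegral_mono fun z => ?_
    rw [← ENNReal.ofReal_mul (by positivity), ← ENNReal.ofReal_mul (by positivity)]
    refine ENNReal.ofReal_le_ofReal (le_of_eq ?_)
    have h1 : t ^ 2 + ‖|t| • z‖ ^ 2 = |t| ^ (2 : ℝ) * (1 + ‖z‖ ^ 2) := by
      rw [norm_smul, Real.norm_of_nonneg ht'.le, Real.rpow_two, mul_pow, sq_abs]
      ring
    rw [h1, Real.mul_rpow (by positivity) (by positivity), ← Real.rpow_mul ht'.le,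
      ← Real.rpow_natCast, ← mul_assoc, ← Real.rpow_add ht', mul_comm]
    congr 2 <;> ring

/-- Fubini, singling out the anisotropic direction. The tail then carries the sup norm, which is
harmless: only the bound of the tail norm by ‖x‖ is needed. -/
theorem lintegral_space_succ {n : ℕ} {g : ℝ → (Fin n → ℝ) → ℝ≥0∞}
    (hg : Measurable (Function.uncurry g)) :
    ∫⁻ x : Space (n + 1), g (x 0) (fun i => x i.succ) = ∫⁻ t, ∫⁻ y, g t y := by
  have h1 := (volume_preserving_piFinSuccAbove (fun _ : Fin (n + 1) => ℝ) 0).comp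
    (PiLp.volume_preserving_ofLp (Fin (n + 1)))
  have h2 := h1.lintegral_comp hg
  rw [Measure.volume_eq_prod, lintegral_prod _ hg.aemeasurable] at h2
  exact h2

theorem abs_coord_le_norm {d : ℕ} (x : Space d) (i : Fin d) : |x i| ≤ ‖x‖ := by
  simpa using PiLp.norm_apply_le x i

theorem norm_tail_le {n : ℕ} (x : Space (n + 1)) : ‖fun i : Fin n => x i.succ‖ ≤ ‖x‖ :=
  (pi_norm_le_iff_of_nonneg (norm_nonneg _)).2 fun i => by
    simpa using abs_coord_le_norm x i.succ

theorem measurable_tail {n : ℕ} : Measurable fun (x : Space (n + 1)) (i : Fin n) => x i.succ := by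
  fun_prop

/-- The bound on slices that is used in the estimate of the exceptional interactions. -/
def SliceBound (n : ℕ) (ρ a : ℝ) : Prop :=
  ∃ C : ℝ≥0∞, C ≠ ⊤ ∧ ∀ t R : ℝ, t ≠ 0 → 0 < R →
    ∫⁻ y : Fin n → ℝ, (closedBall (0 : Fin n → ℝ) R).indicator
      (fun y => ENNReal.ofReal (max |t| ‖y‖ ^ (-(2 * ρ)) * |t| ^ a)) y ≤
      C * ENNReal.ofReal (R ^ (n - 2 * ρ + a))

/-- Of the 2ρ negative powers of the maximum, a are spent on cancelling |t|^a; the others leave a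
singularity in y of order 2ρ - a < n, which is locally integrable. -/
theorem sliceBound_of_lt {n : ℕ} (hn : 0 < n) {ρ a : ℝ} (ha : 0 ≤ a) (haρ : a ≤ 2 * ρ)
    (hρ : 2 * ρ - a < n) : SliceBound n ρ a := by
  have : Nonempty (Fin n) := ⟨⟨0, hn⟩⟩
  obtain ⟨C, hC, h⟩ := exists_lintegral_norm_rpow_le (E := Fin n → ℝ) volume (b := 2 * ρ - a)
    (by simpa) (by simpa)
  refine ⟨C, hC, fun t R ht hR => ?_⟩
  have h1 := h R hR
  simp only [Module.finrank_fin_fun] at h1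
  rw [show (n : ℝ) - 2 * ρ + a = n - (2 * ρ - a) by ring]
  refine le_trans (lintegral_mono_ae ?_) h1
  filter_upwards [Measure.ae_ne volume (0 : Fin n → ℝ)] with y hy
  refine Set.indicator_le_indicator' (fun _ => ENNReal.ofReal_le_ofReal ?_)
  have ht' : 0 < |t| := abs_pos.2 ht
  have hy' : 0 < ‖y‖ := norm_pos_iff.2 hy
  have hm : 0 < max |t| ‖y‖ := lt_max_of_lt_left ht'
  calc max |t| ‖y‖ ^ (-(2 * ρ)) * |t| ^ a
      = max |t| ‖y‖ ^ (-(2 * ρ - a)) * (max |t| ‖y‖ ^ (-a) * |t| ^ a) := by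
        rw [← mul_assoc, ← Real.rpow_add hm]
        congr 2
        ring
    _ ≤ ‖y‖ ^ (-(2 * ρ - a)) * (|t| ^ (-a) * |t| ^ a) := by
        gcongr ?_ * (?_ * _)
        · exact Real.rpow_le_rpow_of_nonpos hy' (le_max_right _ _) (by linarith)
        · exact Real.rpow_le_rpow_of_nonpos ht' (le_max_left _ _) (by linarith)
    _ = _ := by rw [← Real.rpow_add ht', neg_add_cancel, Real.rpow_zero, mul_one]

/-- Here the slice integral converges at infinity and is of order |t|^(n - 2ρ), which a = 2ρ - n
cancels exactly; the power of R becomes 0. -/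
theorem sliceBound_of_gt {n : ℕ} {ρ : ℝ} (hρ : (n : ℝ) < 2 * ρ) :
    SliceBound n ρ (2 * ρ - n) := by
  obtain ⟨C, hC, h⟩ := exists_lintegral_japanese_le (E := Fin n → ℝ) volume (ρ := ρ)
    (by simpa)
  refine ⟨C * ENNReal.ofReal (2 ^ ρ), ENNReal.mul_ne_top hC ENNReal.ofReal_ne_top,
    fun t R ht hR => ?_⟩
  have ht' : 0 < |t| := abs_pos.2 ht
  have h1 := h t ht
  simp only [Module.finrank_fin_fun] at h1
  have h2 : (n : ℝ) - 2 * ρ + (2 * ρ - n) = 0 := by ring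
  rw [h2, Real.rpow_zero, ENNReal.ofReal_one, mul_one]
  have m1 : Measurable fun y : Fin n → ℝ => ENNReal.ofReal ((t ^ 2 + ‖y‖ ^ 2) ^ (-ρ)) := by
    fun_prop
  have hρ0 : 0 < ρ := by
    have : (0 : ℝ) ≤ n := n.cast_nonneg
    linarith
  calc _ ≤ ∫⁻ y : Fin n → ℝ, ENNReal.ofReal ((t ^ 2 + ‖y‖ ^ 2) ^ (-ρ)) *
        ENNReal.ofReal (2 ^ ρ * |t| ^ (2 * ρ - n)) := by
        refine lintegral_mono fun y => (Set.indicator_le_self _ _ _).trans ?_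
        rw [← ENNReal.ofReal_mul (by positivity)]
        refine ENNReal.ofReal_le_ofReal ?_
        rw [← mul_assoc]
        gcongr
        have hm : 0 < max |t| ‖y‖ := lt_max_of_lt_left ht'
        have hle : (t ^ 2 + ‖y‖ ^ 2) / 2 ≤ max |t| ‖y‖ ^ (2 : ℝ) := by
          rw [Real.rpow_two]
          have h3 : t ^ 2 ≤ max |t| ‖y‖ ^ 2 := by
            rw [← sq_abs]
            gcongr
            exact le_max_left _ _
          have h4 : ‖y‖ ^ 2 ≤ max |t| ‖y‖ ^ 2 := by
            gcongr
            exact le_max_right _ _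
          linarith
        have hpos : 0 < t ^ 2 + ‖y‖ ^ 2 := by positivity
        calc max |t| ‖y‖ ^ (-(2 * ρ)) = (max |t| ‖y‖ ^ (2 : ℝ)) ^ (-ρ) := by
              rw [← Real.rpow_mul hm.le]
              congr 1
              ring
          _ ≤ ((t ^ 2 + ‖y‖ ^ 2) / 2) ^ (-ρ) :=
              Real.rpow_le_rpow_of_nonpos (by positivity) hle (by linarith)
          _ = _ := by
              rw [Real.div_rpow hpos.le (by norm_num), Real.rpow_neg (by norm_num : (0:ℝ) ≤ 2),
                div_inv_eq_mul]
    _ ≤ C * ENNReal.ofReal (|t| ^ (n - 2 * ρ)) *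
        ENNReal.ofReal (2 ^ ρ * |t| ^ (2 * ρ - n)) := by
        rw [lintegral_mul_const _ m1]
        gcongr
    _ = _ := by
        rw [mul_assoc, ← ENNReal.ofReal_mul (by positivity)]
        congr 2
        rw [mul_left_comm, ← Real.rpow_add ht']
        rw [show (n : ℝ) - 2 * ρ + (2 * ρ - n) = 0 by ring, Real.rpow_zero, mul_one]

/-- Replacing ‖x‖ by the maximum of |x 0| and the tail norm only enlarges the integrand. Each slice
is then bounded independently of t, and only the Cauchy kernel in t remains. -/
theorem SliceBound.lintegral_le {n : ℕ} {ρ a : ℝ} (hρ : 0 ≤ ρ) (h : SliceBound n ρ a) :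
    ∃ C : ℝ≥0∞, C ≠ ⊤ ∧ ∀ R A c : ℝ, 0 < R → 0 < A →
      ∫⁻ x : Space (n + 1), (closedBall (0 : Space (n + 1)) R).indicator
        (fun x => ENNReal.ofReal
          (‖x‖ ^ (-(2 * ρ)) * |x 0| ^ a * (1 / ((x 0 - c) ^ 2 + A ^ 2)))) x ≤
        C * ENNReal.ofReal (R ^ (n - 2 * ρ + a) * (1 / A)) := by
  obtain ⟨C, hC, hs⟩ := h
  obtain ⟨C', hC', hc⟩ := exists_lintegral_cauchy_le
  refine ⟨C * C', ENNReal.mul_ne_top hC hC', fun R A c hR hA => ?_⟩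
  let g : ℝ → (Fin n → ℝ) → ℝ≥0∞ := fun t y => (closedBall (0 : Fin n → ℝ) R).indicator
    (fun y => ENNReal.ofReal (max |t| ‖y‖ ^ (-(2 * ρ)) * |t| ^ a)) y *
      ENNReal.ofReal (1 / ((t - c) ^ 2 + A ^ 2))
  have mi : Measurable fun p : ℝ × (Fin n → ℝ) => (closedBall (0 : Fin n → ℝ) R).indicator
      (fun y => ENNReal.ofReal (max |p.1| ‖y‖ ^ (-(2 * ρ)) * |p.1| ^ a)) p.2 := by
    have : (fun p : ℝ × (Fin n → ℝ) => (closedBall (0 : Fin n → ℝ) R).indicator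
      (fun y => ENNReal.ofReal (max |p.1| ‖y‖ ^ (-(2 * ρ)) * |p.1| ^ a)) p.2) =
      (Prod.snd ⁻¹' closedBall (0 : Fin n → ℝ) R).indicator
        (fun p => ENNReal.ofReal (max |p.1| ‖p.2‖ ^ (-(2 * ρ)) * |p.1| ^ a)) := rfl
    rw [this]
    refine Measurable.indicator ?_ (measurable_snd measurableSet_closedBall)
    have h1 : Measurable fun p : ℝ × (Fin n → ℝ) => |p.1| := by
      simp only [← Real.norm_eq_abs]
      fun_prop
    have h2 : Measurable fun p : ℝ × (Fin n → ℝ) => ‖p.2‖ := by fun_prop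
    exact (((h1.max h2).pow_const _).mul (h1.pow_const _)).ennreal_ofReal
  have mg : Measurable (Function.uncurry g) :=
    mi.mul (by fun_prop : Measurable fun p : ℝ × (Fin n → ℝ) =>
      ENNReal.ofReal (1 / ((p.1 - c) ^ 2 + A ^ 2)))
  calc _ ≤ ∫⁻ x : Space (n + 1), g (x 0) (fun i => x i.succ) := by
        refine lintegral_mono fun x => ?_
        by_cases hx : x ∈ closedBall (0 : Space (n + 1)) R
        swap
        · rw [Set.indicator_of_notMem hx]
          exact zero_le
        rw [Set.indicator_of_mem hx]
        rw [mem_closedBall_zero_iff] at hx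
        have hx' : (fun i : Fin n => x i.succ) ∈ closedBall (0 : Fin n → ℝ) R := by
          rw [mem_closedBall_zero_iff]
          exact (norm_tail_le x).trans hx
        simp only [g]
        rw [Set.indicator_of_mem hx', ← ENNReal.ofReal_mul (by positivity)]
        refine ENNReal.ofReal_le_ofReal ?_
        gcongr ?_ * _ * _
        have hle : max |x 0| ‖fun i : Fin n => x i.succ‖ ≤ ‖x‖ :=
          max_le (abs_coord_le_norm x 0) (norm_tail_le x)
        -- Monotonicity of negative powers needs a positive base; in the degenerate case x = 0 and
        -- both sides are the same power of 0.
        rcases (le_max_of_le_left (abs_nonneg _) :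
          0 ≤ max |x 0| ‖fun i : Fin n => x i.succ‖).eq_or_lt with h0 | h0
        · have hx0 : x = 0 := by
            have h1 : |x 0| ≤ 0 := h0 ▸ le_max_left _ _
            have h2 : ‖fun i : Fin n => x i.succ‖ ≤ 0 := h0 ▸ le_max_right _ _
            ext i
            refine Fin.cases ?_ (fun j => ?_) i
            · simpa using h1
            · exact congrFun (norm_le_zero_iff.1 h2) j
          rw [← h0, hx0, norm_zero]
        · exact Real.rpow_le_rpow_of_nonpos h0 hle (by linarith)
    _ = ∫⁻ t, ∫⁻ y, g t y := lintegral_space_succ mg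
    _ ≤ ∫⁻ t : ℝ, C * ENNReal.ofReal (R ^ (n - 2 * ρ + a)) *
          ENNReal.ofReal (1 / ((t - c) ^ 2 + A ^ 2)) := by
        refine lintegral_mono_ae ?_
        filter_upwards [Measure.ae_ne volume (0 : ℝ)] with t ht
        simp only [g]
        rw [lintegral_mul_const' _ _ ENNReal.ofReal_ne_top]
        gcongr
        exact hs t R ht hR
    _ ≤ C * ENNReal.ofReal (R ^ (n - 2 * ρ + a)) * (C' * ENNReal.ofReal (1 / A)) := by
        rw [lintegral_const_mul _ (by fun_prop)]
        gcongr
        exact hc A c hA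
    _ = _ := by
        rw [ENNReal.ofReal_mul (by positivity)]
        ring

/-! ### The weight and the integrability of its reciprocal -/

section weight

variable {d : ℕ} [NeZero d] {s r δ : ℝ}

theorem weight_of_lt {ξ : Space d} (h : ‖ξ‖ < 1) :
    weight s r δ ξ = (ξ 0 ^ 2 + ‖ξ‖ ^ (2 * δ)) / ‖ξ‖ ^ (2 * r) := by
  have h1 : ξ ∈ ball (0 : Space d) 1 := mem_ball_zero_iff.2 h
  rw [weight, Set.indicator_of_mem h1, Set.indicator_of_notMem (by simpa using h), add_zero,
    sq_abs]

theorem weight_of_ge {ξ : Space d} (h : 1 ≤ ‖ξ‖) : weight s r δ ξ = (1 + ‖ξ‖ ^ 2) ^ s := by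
  have h1 : ξ ∈ (ball (0 : Space d) 1)ᶜ := by simpa using h
  rw [weight, Set.indicator_of_mem h1, Set.indicator_of_notMem h1, zero_add, Real.sqrt_eq_rpow,
    ← Real.rpow_mul (by positivity)]
  congr 1
  ring

theorem weight_pos {ξ : Space d} (h : ξ ≠ 0) : 0 < weight s r δ ξ := by
  have h0 : 0 < ‖ξ‖ := norm_pos_iff.2 h
  rcases lt_or_ge ‖ξ‖ 1 with h1 | h1
  · rw [weight_of_lt h1]
    positivity
  · rw [weight_of_ge h1]
    positivity

/-- A weighted geometric mean of the two terms of the numerator is at most their sum. The exponent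
(1 - ε)/2 keeps the singularity in the first coordinate just below order 1, thus integrable, at
minimal cost in ‖ξ‖. -/
theorem inv_weight_le_of_lt {ε b : ℝ} (hε0 : 0 < ε) (hε1 : ε < 1) (hb0 : 0 ≤ b)
    (hb : δ * (1 + ε) - 2 * r ≤ b) {ξ : Space d} (h1 : ‖ξ‖ < 1) (h0 : ξ 0 ≠ 0) {y : ℝ}
    (hy0 : 0 < y) (hy : y ≤ ‖ξ‖) :
    (weight s r δ ξ)⁻¹ ≤ |ξ 0| ^ (-(1 - ε)) * y ^ (-b) := by
  have hξ : 0 < ‖ξ‖ := hy0.trans_le hy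
  have ht : 0 < |ξ 0| := abs_pos.2 h0
  set θ : ℝ := (1 - ε) / 2 with hθ
  set M : ℝ := ξ 0 ^ 2 + ‖ξ‖ ^ (2 * δ) with hM
  have hM0 : 0 < M := by positivity
  have key : |ξ 0| ^ (1 - ε) * ‖ξ‖ ^ (δ * (1 + ε)) ≤ M := by
    calc |ξ 0| ^ (1 - ε) * ‖ξ‖ ^ (δ * (1 + ε))
        = (ξ 0 ^ 2) ^ θ * (‖ξ‖ ^ (2 * δ)) ^ (1 - θ) := by
          rw [← sq_abs, ← Real.rpow_natCast, ← Real.rpow_mul ht.le, ← Real.rpow_mul hξ.le]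
          congr 2
          · rw [hθ]; push_cast; ring
          · rw [hθ]; ring
      _ ≤ M ^ θ * M ^ (1 - θ) := by
          have : 0 ≤ θ := by rw [hθ]; linarith
          have : 0 ≤ 1 - θ := by rw [hθ]; linarith
          have : 0 ≤ ‖ξ‖ ^ (2 * δ) := by positivity
          gcongr
          · linarith
          · nlinarith [sq_nonneg (ξ 0)]
      _ = M := by rw [← Real.rpow_add hM0]; simp
  rw [weight_of_lt h1, inv_div]
  calc ‖ξ‖ ^ (2 * r) / M ≤ ‖ξ‖ ^ (2 * r) / (|ξ 0| ^ (1 - ε) * ‖ξ‖ ^ (δ * (1 + ε))) := by gcongr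
    _ = |ξ 0| ^ (-(1 - ε)) * ‖ξ‖ ^ (2 * r - δ * (1 + ε)) := by
        rw [Real.rpow_neg ht.le, Real.rpow_sub hξ]
        field_simp
    _ ≤ |ξ 0| ^ (-(1 - ε)) * ‖ξ‖ ^ (-b) := by
        gcongr _ * ?_
        exact Real.rpow_le_rpow_of_exponent_ge hξ h1.le (by linarith)
    _ ≤ _ := by
        gcongr _ * ?_
        exact Real.rpow_le_rpow_of_nonpos hy0 hy (by linarith)

end weight

theorem ae_coord_ne_zero {n : ℕ} (hn : 0 < n) :
    ∀ᵐ ξ : Space (n + 1), ξ 0 ≠ 0 ∧ (fun i : Fin n => ξ i.succ) ≠ 0 := by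
  have hne : Nonempty (Fin n) := ⟨⟨0, hn⟩⟩
  let I : ℝ × (Fin n → ℝ) → ℝ≥0∞ := {p | p.1 = 0 ∨ p.2 = 0}.indicator 1
  have mI : Measurable I := measurable_const.indicator
    ((measurable_fst (measurableSet_singleton 0)).union
      (measurable_snd (measurableSet_singleton 0)))
  have h := lintegral_space_succ (n := n) (g := fun t y => I (t, y)) mI
  have h3 : ∫⁻ t : ℝ, ∫⁻ y : Fin n → ℝ, I (t, y) = 0 := by
    rw [lintegral_eq_zero_iff' (Measurable.lintegral_prod_right' mI).aemeasurable]
    filter_upwards [Measure.ae_ne volume (0 : ℝ)] with t ht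
    have mt : Measurable fun y => I (t, y) := mI.comp measurable_prodMk_left
    rw [Pi.zero_apply, lintegral_eq_zero_iff' mt.aemeasurable]
    filter_upwards [Measure.ae_ne volume (0 : Fin n → ℝ)] with y hy
    simp [I, ht, hy]
  have mI' : Measurable fun x : Space (n + 1) => I (x 0, fun i => x i.succ) :=
    mI.comp ((by fun_prop : Measurable fun x : Space (n + 1) => x 0).prodMk measurable_tail)
  rw [h3, lintegral_eq_zero_iff' mI'.aemeasurable] at h
  filter_upwards [h] with ξ hξ
  simpa [I] using hξ

theorem lintegral_inv_weight_lt_top {n : ℕ} (hn : 0 < n) {s r δ : ℝ} (hδ : 0 < δ)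
    (hd : δ - 2 * r < n) (hs : ((n + 1 : ℕ) : ℝ) / 2 < s) :
    ∫⁻ ξ : Space (n + 1), ENNReal.ofReal (weight s r δ ξ)⁻¹ < ⊤ := by
  have hne : Nonempty (Fin n) := ⟨⟨0, hn⟩⟩
  have hn' : (0 : ℝ) < n := Nat.cast_pos.2 hn
  -- The loss δε may use at most half of the gap n + 2r - δ.
  obtain ⟨ε, hε0, hε1, hε2⟩ : ∃ ε : ℝ, 0 < ε ∧ ε < 1 ∧ δ * (1 + ε) - 2 * r < n := by
    refine ⟨min (1 / 2) ((n + 2 * r - δ) / (2 * δ)), lt_min (by norm_num)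
      (div_pos (by linarith) (by linarith)), (min_le_left _ _).trans_lt (by norm_num), ?_⟩
    have h1 : δ * min (1 / 2) ((n + 2 * r - δ) / (2 * δ)) ≤ (n + 2 * r - δ) / 2 := by
      calc _ ≤ δ * ((n + 2 * r - δ) / (2 * δ)) := by
            gcongr
            exact min_le_right _ _
        _ = _ := by field_simp
    linarith
  -- A nonnegative exponent is required to pass from ‖ξ‖ to the smaller norm of the tail.
  set b := max 0 (δ * (1 + ε) - 2 * r) with hb
  obtain ⟨C₁, hC₁, h₁⟩ := exists_lintegral_norm_rpow_le (E := ℝ) volume (b := 1 - ε)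
    (by simp) (by simpa using hε0)
  obtain ⟨C₂, hC₂, h₂⟩ := exists_lintegral_norm_rpow_le (E := Fin n → ℝ) volume (b := b)
    (by simpa) (by simpa only [Module.finrank_fin_fun] using max_lt hn' hε2)
  have e₁ := h₁ 1 one_pos
  have e₂ := h₂ 1 one_pos
  simp only [Real.one_rpow, ENNReal.ofReal_one, mul_one] at e₁ e₂
  set f₁ : ℝ → ℝ≥0∞ := (closedBall (0 : ℝ) 1).indicator
    (fun y => ENNReal.ofReal (‖y‖ ^ (-(1 - ε)))) with hf₁
  set f₂ : (Fin n → ℝ) → ℝ≥0∞ := (closedBall (0 : Fin n → ℝ) 1).indicator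
    (fun y => ENNReal.ofReal (‖y‖ ^ (-b))) with hf₂
  have m₁ : Measurable f₁ := (by fun_prop : Measurable fun y : ℝ =>
    ENNReal.ofReal (‖y‖ ^ (-(1 - ε)))).indicator measurableSet_closedBall
  have m₂ : Measurable f₂ := (by fun_prop : Measurable fun y : Fin n → ℝ =>
    ENNReal.ofReal (‖y‖ ^ (-b))).indicator measurableSet_closedBall
  have mg : Measurable (Function.uncurry fun t y => f₁ t * f₂ y) :=
    (m₁.comp measurable_fst).mul (m₂.comp measurable_snd)
  have hint := integrable_rpow_neg_one_add_norm_sq (E := Space (n + 1)) (μ := volume)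
    (r := 2 * s) (by simp only [finrank_euclideanSpace, Fintype.card_fin]; linarith)
  have hfin := hint.2
  rw [hasFiniteIntegral_iff_ofReal (Eventually.of_forall fun y => by positivity)] at hfin
  have hz1 := ae_coord_ne_zero hn
  calc ∫⁻ ξ : Space (n + 1), ENNReal.ofReal (weight s r δ ξ)⁻¹
      ≤ ∫⁻ ξ : Space (n + 1), (f₁ (ξ 0) * f₂ (fun i => ξ i.succ) +
          ENNReal.ofReal ((1 + ‖ξ‖ ^ 2) ^ (-(2 * s) / 2))) := by
        refine lintegral_mono_ae ?_
        filter_upwards [hz1] with ξ hξ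
        rcases lt_or_ge ‖ξ‖ 1 with h1 | h1
        · refine le_add_right ?_
          have ht : ξ 0 ∈ closedBall (0 : ℝ) 1 := by
            rw [mem_closedBall_zero_iff]
            exact (abs_coord_le_norm ξ 0).trans h1.le
          have hy : (fun i : Fin n => ξ i.succ) ∈ closedBall (0 : Fin n → ℝ) 1 := by
            rw [mem_closedBall_zero_iff]
            exact (norm_tail_le ξ).trans h1.le
          rw [hf₁, hf₂, Set.indicator_of_mem ht, Set.indicator_of_mem hy,
            ← ENNReal.ofReal_mul (by positivity)]
          exact ENNReal.ofReal_le_ofReal (inv_weight_le_of_lt hε0 hε1 (le_max_left _ _)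
            (le_max_right _ _) h1 hξ.1 (norm_pos_iff.2 hξ.2) (norm_tail_le ξ))
        · refine le_add_left (ENNReal.ofReal_le_ofReal (le_of_eq ?_))
          rw [weight_of_ge h1, ← Real.rpow_neg (by positivity)]
          congr 1
          ring
    _ = (∫⁻ t, ∫⁻ y, f₁ t * f₂ y) +
          ∫⁻ ξ : Space (n + 1), ENNReal.ofReal ((1 + ‖ξ‖ ^ 2) ^ (-(2 * s) / 2)) := by
        rw [lintegral_add_right _ (by fun_prop), ← lintegral_space_succ mg]
    _ < ⊤ := by
        refine ENNReal.add_lt_top.2 ⟨?_, hfin⟩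
        have : ∀ t, ∫⁻ y, f₁ t * f₂ y = f₁ t * ∫⁻ y, f₂ y := fun t => lintegral_const_mul _ m₂
        simp only [this]
        rw [lintegral_mul_const _ m₁]
        exact ENNReal.mul_lt_top (e₁.trans_lt hC₁.lt_top) (e₂.trans_lt hC₂.lt_top)

/-- Cauchy–Schwarz applied to |w|² = W⁻¹ · (W |w|²), valid off the origin. -/
theorem integrable_of_energy_lt_top {d : ℕ} [NeZero d] {s r δ : ℝ}
    (hint : ∫⁻ ξ : Space d, ENNReal.ofReal (weight s r δ ξ)⁻¹ < ⊤) {w : Space d → ℂ}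
    (hw : AEStronglyMeasurable w) (h : energy s r δ w < ⊤) : Integrable w := by
  refine ⟨hw, ?_⟩
  have mW := (measurable_weight (d := d) s r δ)
  have hle : ∫⁻ ξ, ‖w ξ‖ₑ ≤ ∫⁻ ξ, (ENNReal.ofReal (weight s r δ ξ)⁻¹ *
      (ENNReal.ofReal (weight s r δ ξ) * ‖w ξ‖ₑ ^ 2)) ^ (1 / 2 : ℝ) := by
    refine lintegral_mono_ae ?_
    filter_upwards [Measure.ae_ne volume (0 : Space d)] with ξ hξ
    have hp : 0 < weight s r δ ξ := weight_pos hξ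
    rw [← mul_assoc, ← ENNReal.ofReal_mul (by positivity), inv_mul_cancel₀ hp.ne',
      ENNReal.ofReal_one, one_mul, ← ENNReal.rpow_natCast, ← ENNReal.rpow_mul]
    norm_num
  have h2 := sq_lintegral_rpow_half_le (μ := volume) (mW.inv.ennreal_ofReal.aemeasurable)
    ((mW.ennreal_ofReal.aemeasurable).mul (hw.enorm.pow_const 2))
  have h3 : (∫⁻ ξ, ‖w ξ‖ₑ) ^ 2 < ⊤ :=
    ((pow_le_pow_left' hle 2).trans h2).trans_lt (ENNReal.mul_lt_top hint h)
  exact (ENNReal.pow_lt_top_iff.1 h3).resolve_right (by norm_num)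

/-! ### Pointwise bounds for the weight of a sum -/

/-- The weight at low frequencies, in terms of the first coordinate and the norm. -/
def lowWeight (r δ t p : ℝ) : ℝ := (t ^ 2 + p ^ (2 * δ)) / p ^ (2 * r)

section lowWeight

variable {r δ t₁ t₂ p q m : ℝ}

/-- With the output size m comparable to the larger input size p, no product of weights is needed:
since r > 0 and q ≤ p, the term t₂² / p^(2r) is absorbed by the weight at q. -/
theorem lowWeight_add_le_of_half_le (hδ : 0 < δ) (hr : 0 < r) (hp : 0 < p) (hq : 0 < q)
    (hm : 0 < m) (hqp : q ≤ p) (hmp : m ≤ 2 * p) (hpm : p ≤ 2 * m) :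
    lowWeight r δ (t₁ + t₂) m ≤
      (2 + 2 ^ (2 * δ)) * 2 ^ (2 * r) * (lowWeight r δ t₁ p + lowWeight r δ t₂ q) := by
  have h1 : p ^ (2 * r) ≤ 2 ^ (2 * r) * m ^ (2 * r) := by
    rw [← Real.mul_rpow (by norm_num) hm.le]
    gcongr
  have h2 : m ^ (2 * δ) ≤ 2 ^ (2 * δ) * p ^ (2 * δ) := by
    rw [← Real.mul_rpow (by norm_num) hp.le]
    gcongr
  have hpr : 0 < p ^ (2 * r) := by positivity
  have hpd : 0 < p ^ (2 * δ) := by positivity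
  have hqd : 0 < q ^ (2 * δ) := by positivity
  have h2d : 0 < (2 : ℝ) ^ (2 * δ) := by positivity
  have hnum : (t₁ + t₂) ^ 2 + m ^ (2 * δ) ≤
      (2 + 2 ^ (2 * δ)) * ((t₁ ^ 2 + p ^ (2 * δ)) + t₂ ^ 2) := by
    nlinarith [sq_nonneg (t₁ - t₂), mul_nonneg h2d.le (sq_nonneg t₁),
      mul_nonneg h2d.le (sq_nonneg t₂)]
  calc lowWeight r δ (t₁ + t₂) m
      ≤ (2 + 2 ^ (2 * δ)) * ((t₁ ^ 2 + p ^ (2 * δ)) + t₂ ^ 2) / (p ^ (2 * r) / 2 ^ (2 * r)) := by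
        unfold lowWeight
        gcongr
        rw [div_le_iff₀ (by positivity)]
        linarith
    _ = (2 + 2 ^ (2 * δ)) * 2 ^ (2 * r) *
          (lowWeight r δ t₁ p + t₂ ^ 2 / p ^ (2 * r)) := by
        unfold lowWeight
        field_simp
    _ ≤ _ := by
        unfold lowWeight
        gcongr
        linarith

/-- The isotropic part of the output weight increases with m because r ≤ δ, so only t² m^(-2r) is
dangerous. The parameter a retains a factor |t|^a, which later softens the singularity m^(-2r), at
the price p^(-δa). -/
theorem lowWeight_add_le_of_comparable (hδ : 0 < δ) (hr : 0 < r) (hrδ : r ≤ δ) {a : ℝ}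
    (ha : 0 ≤ a) (ha2 : a ≤ 2) (hp : 0 < p) (hq : 0 < q) (hm : 0 < m) (hmp : m ≤ p)
    (hpq : p ≤ 2 * q) (hqp : q ≤ 2 * p) (ht : |t₂| ≤ |t₁|) :
    lowWeight r δ (t₁ + t₂) m ≤ 4 * 2 ^ (2 * δ) * 2 ^ (2 * r) *
      (lowWeight r δ t₁ p + lowWeight r δ t₁ p * lowWeight r δ t₂ q *
        (m ^ (-(2 * r)) * |t₁ + t₂| ^ a * (1 / (t₂ ^ 2 + (p ^ δ) ^ 2)) *
          p ^ (4 * r - δ * a))) := by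
  set t := t₁ + t₂ with htt
  have hpd2 : (p ^ δ) ^ 2 = p ^ (2 * δ) := by
    rw [← Real.rpow_natCast, ← Real.rpow_mul hp.le]
    congr 1
    push_cast
    ring
  rw [hpd2]
  have hpr : 0 < p ^ (2 * r) := by positivity
  have hpd : 0 < p ^ (2 * δ) := by positivity
  set A := t₁ ^ 2 + p ^ (2 * δ) with hA
  set B := t₂ ^ 2 + p ^ (2 * δ) with hB
  have hA0 : 0 < A := by positivity
  have hB0 : 0 < B := by positivity
  have k1 : 1 ≤ (2 : ℝ) ^ (2 * δ) := Real.one_le_rpow (by norm_num) (by linarith)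
  have k2 : 1 ≤ (2 : ℝ) ^ (2 * r) := Real.one_le_rpow (by norm_num) (by linarith)
  -- With x = |t| / p^δ: if x ≥ 1, then t² ≤ 4t₁² and the extra factor is at least 1; if x ≤ 1, then
  -- t² = p^(2δ) x² ≤ A x^a because a ≤ 2.
  have hmain : t ^ 2 ≤ 4 * A * (|t| ^ a * p ^ (-(δ * a))) := by
    have hx : |t| ^ a * p ^ (-(δ * a)) = (|t| / p ^ δ) ^ a := by
      rw [Real.div_rpow (abs_nonneg _) (by positivity), ← Real.rpow_mul hp.le, Real.rpow_neg hp.le]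
      rfl
    rw [hx]
    have ht4 : t ^ 2 ≤ 4 * t₁ ^ 2 := by
      have := sq_le_sq.2 ht
      rw [htt]
      nlinarith [sq_nonneg (t₁ - t₂)]
    rcases le_total (p ^ δ) |t| with hc | hc
    · have : 1 ≤ (|t| / p ^ δ) ^ a :=
        Real.one_le_rpow ((one_le_div (by positivity)).2 hc) ha
      nlinarith
    · set x := |t| / p ^ δ with hxd
      have hx0 : 0 ≤ x := by positivity
      have hx1 : x ≤ 1 := (div_le_one (by positivity)).2 hc
      have hxa : x ^ (2 : ℝ) ≤ x ^ a := Real.rpow_le_rpow_of_exponent_ge_of_imp hx0 hx1 ha2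
        (by intro h h2; linarith)
      have ht2 : t ^ 2 = p ^ (2 * δ) * x ^ (2 : ℝ) := by
        rw [Real.rpow_two, hxd, div_pow, sq_abs, hpd2]
        field_simp
      have hxa0 : 0 ≤ x ^ a := by positivity
      rw [ht2]
      calc p ^ (2 * δ) * x ^ (2 : ℝ) ≤ A * x ^ a := by
            gcongr
            rw [hA]
            linarith [sq_nonneg t₁]
        _ ≤ _ := by nlinarith [mul_nonneg hA0.le hxa0]
  have hq2 : B / p ^ (2 * r) ≤ 2 ^ (2 * δ) * 2 ^ (2 * r) * lowWeight r δ t₂ q := by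
    have h1 : p ^ (2 * δ) ≤ 2 ^ (2 * δ) * q ^ (2 * δ) := by
      rw [← Real.mul_rpow (by norm_num) hq.le]
      gcongr
    have h2 : q ^ (2 * r) ≤ 2 ^ (2 * r) * p ^ (2 * r) := by
      rw [← Real.mul_rpow (by norm_num) hp.le]
      gcongr
    have hqr : 0 < q ^ (2 * r) := by positivity
    unfold lowWeight
    rw [← mul_div_assoc, div_le_div_iff₀ hpr hqr]
    have h3 : B ≤ 2 ^ (2 * δ) * (t₂ ^ 2 + q ^ (2 * δ)) := by
      rw [hB]
      nlinarith [mul_nonneg (sub_nonneg.2 k1) (sq_nonneg t₂)]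
    calc B * q ^ (2 * r) ≤ (2 ^ (2 * δ) * (t₂ ^ 2 + q ^ (2 * δ))) *
          (2 ^ (2 * r) * p ^ (2 * r)) := by gcongr
      _ = _ := by ring
  have hlw : lowWeight r δ t m = t ^ 2 * m ^ (-(2 * r)) + m ^ (2 * δ - 2 * r) := by
    unfold lowWeight
    rw [Real.rpow_sub hm, Real.rpow_neg hm.le]
    ring
  have h5 : m ^ (2 * δ - 2 * r) ≤ lowWeight r δ t₁ p := by
    calc m ^ (2 * δ - 2 * r) ≤ p ^ (2 * δ - 2 * r) :=
          Real.rpow_le_rpow hm.le hmp (by linarith)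
      _ = p ^ (2 * δ) / p ^ (2 * r) := Real.rpow_sub hp _ _
      _ ≤ _ := by
          unfold lowWeight
          gcongr
          linarith [sq_nonneg t₁]
  have h6 : t ^ 2 * m ^ (-(2 * r)) ≤ 4 * 2 ^ (2 * δ) * 2 ^ (2 * r) *
      (lowWeight r δ t₁ p * lowWeight r δ t₂ q *
        (m ^ (-(2 * r)) * |t| ^ a * (1 / B) * p ^ (4 * r - δ * a))) := by
    have e1 : p ^ (4 * r - δ * a) = p ^ (2 * r) * p ^ (2 * r) * p ^ (-(δ * a)) := by
      rw [← Real.rpow_add hp, ← Real.rpow_add hp]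
      congr 1
      ring
    calc t ^ 2 * m ^ (-(2 * r)) ≤ 4 * A * (|t| ^ a * p ^ (-(δ * a))) * m ^ (-(2 * r)) := by
          gcongr
      _ = 4 * (A / p ^ (2 * r) * (B / p ^ (2 * r)) *
            (m ^ (-(2 * r)) * |t| ^ a * (1 / B) * p ^ (4 * r - δ * a))) := by
          rw [e1]
          field_simp
      _ ≤ 4 * (A / p ^ (2 * r) * (2 ^ (2 * δ) * 2 ^ (2 * r) * lowWeight r δ t₂ q) *
            (m ^ (-(2 * r)) * |t| ^ a * (1 / B) * p ^ (4 * r - δ * a))) := by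
          gcongr
      _ = _ := by
          unfold lowWeight
          ring
  have hlw0 : 0 ≤ lowWeight r δ t₁ p := by
    unfold lowWeight
    positivity
  have hk : 1 ≤ 4 * (2 : ℝ) ^ (2 * δ) * 2 ^ (2 * r) := by nlinarith
  rw [hlw, mul_add]
  nlinarith [mul_le_mul_of_nonneg_right hk hlw0]

/-- For r ≤ 0 the factor p^(-2r) grows with p, so the problematic term is t₂² p^(-2r). If q > 2m,
then p ≤ 2q and the weight at q absorbs it; otherwise it is compared with the product of the two
weights. -/
theorem lowWeight_add_le_of_nonpos (hδ : 0 < δ) (hr : r ≤ 0) (hp : 0 < p) (hq : 0 < q)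
    (hm : 0 < m) (hmp : m ≤ 2 * p) (hpm : p ≤ m + q) :
    lowWeight r δ (t₁ + t₂) m ≤ (2 + 2 ^ (2 * δ)) * 2 ^ (-(2 * r)) * (2 ^ (2 * δ) +
      2 ^ (-(2 * r))) *
      (lowWeight r δ t₁ p + lowWeight r δ t₂ q + lowWeight r δ t₁ p * lowWeight r δ t₂ q *
        (if q ≤ 2 * m then q ^ (2 * r) * (1 / (t₁ ^ 2 + (m ^ δ) ^ 2)) else 0)) := by
  have hmd2 : (m ^ δ) ^ 2 = m ^ (2 * δ) := by
    rw [← Real.rpow_natCast, ← Real.rpow_mul hm.le]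
    congr 1
    push_cast
    ring
  rw [hmd2]
  have e : ∀ t x : ℝ, 0 < x → lowWeight r δ t x = (t ^ 2 + x ^ (2 * δ)) * x ^ (-(2 * r)) :=
    fun t x hx => by rw [lowWeight, Real.rpow_neg hx.le, div_eq_mul_inv]
  have h1 : m ^ (-(2 * r)) ≤ 2 ^ (-(2 * r)) * p ^ (-(2 * r)) := by
    rw [← Real.mul_rpow (by norm_num) hp.le]
    exact Real.rpow_le_rpow hm.le hmp (by linarith)
  have h2 : m ^ (2 * δ) ≤ 2 ^ (2 * δ) * p ^ (2 * δ) := by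
    rw [← Real.mul_rpow (by norm_num) hp.le]
    gcongr
  have hpr : 0 < p ^ (-(2 * r)) := by positivity
  have hpd : 0 < p ^ (2 * δ) := by positivity
  have hqd : 0 < q ^ (2 * δ) := by positivity
  have hqr : 0 < q ^ (-(2 * r)) := by positivity
  have k1 : 1 ≤ (2 : ℝ) ^ (2 * δ) := Real.one_le_rpow (by norm_num) (by linarith)
  have k2 : 1 ≤ (2 : ℝ) ^ (-(2 * r)) := Real.one_le_rpow (by norm_num) (by linarith)
  have hnum : (t₁ + t₂) ^ 2 + m ^ (2 * δ) ≤
      (2 + 2 ^ (2 * δ)) * ((t₁ ^ 2 + p ^ (2 * δ)) + t₂ ^ 2) := by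
    nlinarith [sq_nonneg (t₁ - t₂), mul_nonneg (zero_le_one.trans k1) (sq_nonneg t₁),
      mul_nonneg (zero_le_one.trans k1) (sq_nonneg t₂)]
  have n1 : 0 ≤ lowWeight r δ t₁ p := by unfold lowWeight; positivity
  have n2 : 0 ≤ lowWeight r δ t₂ q := by unfold lowWeight; positivity
  set κ : ℝ := if q ≤ 2 * m then q ^ (2 * r) * (1 / (t₁ ^ 2 + m ^ (2 * δ))) else 0 with hκ
  have nκ : 0 ≤ κ := by
    rw [hκ]
    split_ifs <;> positivity
  have n3 := mul_nonneg (mul_nonneg n1 n2) nκ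
  have hrest : t₂ ^ 2 * p ^ (-(2 * r)) ≤ 2 ^ (-(2 * r)) * lowWeight r δ t₂ q +
      2 ^ (2 * δ) * (lowWeight r δ t₁ p * lowWeight r δ t₂ q * κ) := by
    by_cases hc : q ≤ 2 * m
    · have h3 : t₂ ^ 2 * p ^ (-(2 * r)) ≤
          2 ^ (2 * δ) * (lowWeight r δ t₁ p * lowWeight r δ t₂ q * κ) := by
        rw [hκ, if_pos hc, e _ _ hp, e _ _ hq, Real.rpow_neg hq.le]
        have hD : 0 < t₁ ^ 2 + m ^ (2 * δ) := by positivity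
        have hq2 : 0 < q ^ (2 * r) := by positivity
        have h4 : t₁ ^ 2 + m ^ (2 * δ) ≤ 2 ^ (2 * δ) * (t₁ ^ 2 + p ^ (2 * δ)) := by
          nlinarith [mul_nonneg (sub_nonneg.2 k1) (sq_nonneg t₁)]
        calc t₂ ^ 2 * p ^ (-(2 * r))
            = (t₁ ^ 2 + m ^ (2 * δ)) * (p ^ (-(2 * r)) * t₂ ^ 2 *
                (1 / (t₁ ^ 2 + m ^ (2 * δ)))) := by field_simp
          _ ≤ (2 ^ (2 * δ) * (t₁ ^ 2 + p ^ (2 * δ))) * (p ^ (-(2 * r)) *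
                (t₂ ^ 2 + q ^ (2 * δ)) * (1 / (t₁ ^ 2 + m ^ (2 * δ)))) := by
              gcongr
              linarith
          _ = _ := by field_simp
      have := mul_nonneg (zero_le_one.trans k2) n2
      linarith
    · have h3 : p ^ (-(2 * r)) ≤ 2 ^ (-(2 * r)) * q ^ (-(2 * r)) := by
        rw [← Real.mul_rpow (by norm_num) hq.le]
        exact Real.rpow_le_rpow hp.le (by linarith) (by linarith)
      have h4 : t₂ ^ 2 * p ^ (-(2 * r)) ≤ 2 ^ (-(2 * r)) * lowWeight r δ t₂ q := by
        rw [e _ _ hq]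
        calc t₂ ^ 2 * p ^ (-(2 * r)) ≤ (t₂ ^ 2 + q ^ (2 * δ)) *
              (2 ^ (-(2 * r)) * q ^ (-(2 * r))) := by
              gcongr
              linarith
          _ = _ := by ring
      have := mul_nonneg (zero_le_one.trans k1) n3
      linarith
  calc lowWeight r δ (t₁ + t₂) m
      ≤ (2 + 2 ^ (2 * δ)) * ((t₁ ^ 2 + p ^ (2 * δ)) + t₂ ^ 2) *
          (2 ^ (-(2 * r)) * p ^ (-(2 * r))) := by
        rw [e _ _ hm]
        gcongr
    _ = (2 + 2 ^ (2 * δ)) * 2 ^ (-(2 * r)) *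
          (lowWeight r δ t₁ p + t₂ ^ 2 * p ^ (-(2 * r))) := by
        rw [e _ _ hp]
        ring
    _ ≤ (2 + 2 ^ (2 * δ)) * 2 ^ (-(2 * r)) * ((2 ^ (2 * δ) + 2 ^ (-(2 * r))) *
      (lowWeight r δ t₁ p + lowWeight r δ t₂ q + lowWeight r δ t₁ p * lowWeight r δ t₂ q * κ)) := by
        gcongr
        set X := lowWeight r δ t₁ p
        set Y := lowWeight r δ t₂ q
        set Z := X * Y * κ
        have := mul_nonneg (sub_nonneg.2 k1) n1
        have := mul_nonneg (zero_le_one.trans k2) n1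
        have := mul_nonneg (zero_le_one.trans k1) n2
        have := mul_nonneg (zero_le_one.trans k2) n3
        nlinarith
    _ = _ := by ring

end lowWeight

section

variable {d : ℕ} [NeZero d] {s r δ : ℝ}

theorem weight_eq_lowWeight {ξ : Space d} (h : ‖ξ‖ < 1) :
    weight s r δ ξ = lowWeight r δ (ξ 0) ‖ξ‖ := weight_of_lt h

theorem weight_zero (hδ : 0 < δ) : weight s r δ (0 : Space d) = 0 := by
  rw [weight_of_lt (by simp)]
  simp [Real.zero_rpow (by positivity : 2 * δ ≠ 0)]

theorem weight_nonneg (hδ : 0 < δ) (ξ : Space d) : 0 ≤ weight s r δ ξ := by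
  rcases eq_or_ne ξ 0 with h | h
  · rw [h, weight_zero hδ]
  · exact (weight_pos h).le

theorem weight_le_two (hδ : 1 < δ) (hr : r ≤ 1) {ξ : Space d} (h : ‖ξ‖ < 1) :
    weight s r δ ξ ≤ 2 := by
  rcases eq_or_ne ξ 0 with h0 | h0
  · rw [h0, weight_zero (by linarith)]
    norm_num
  · have hp : 0 < ‖ξ‖ := norm_pos_iff.2 h0
    rw [weight_of_lt h, div_le_iff₀ (by positivity)]
    have h1 : ξ 0 ^ 2 ≤ ‖ξ‖ ^ (2 : ℝ) := by
      rw [Real.rpow_two, ← sq_abs]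
      gcongr
      exact abs_coord_le_norm ξ 0
    have h2 : ‖ξ‖ ^ (2 : ℝ) ≤ ‖ξ‖ ^ (2 * r) :=
      Real.rpow_le_rpow_of_exponent_ge hp h.le (by linarith)
    have h3 : ‖ξ‖ ^ (2 * δ) ≤ ‖ξ‖ ^ (2 * r) :=
      Real.rpow_le_rpow_of_exponent_ge hp h.le (by linarith)
    linarith

/-- Away from the origin the weight is bounded below and comparable to (1 + ‖η‖²)^s, and ‖η + ζ‖ ≤
2‖η‖. The condition r ≤ 1 keeps the weight of the sum bounded when that sum is close to 0. -/
theorem weight_add_le_of_half_le (hδ : 1 < δ) (hr : r ≤ 1) (hs : 0 < s) {η ζ : Space d}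
    (h : ‖ζ‖ ≤ ‖η‖) (hη : 1 / 2 ≤ ‖η‖) :
    weight s r δ (η + ζ) ≤ (2 + 8 ^ s) * 2 ^ (2 * δ - 2 * r) * weight s r δ η := by
  have hm : ‖η + ζ‖ ≤ 2 * ‖η‖ := (norm_add_le _ _).trans (by linarith)
  have k : 1 ≤ (2 : ℝ) ^ (2 * δ - 2 * r) := Real.one_le_rpow (by norm_num) (by linarith)
  have k8 : 0 < (8 : ℝ) ^ s := by positivity
  have k4 : (4 : ℝ) ^ s ≤ 8 ^ s := Real.rpow_le_rpow (by norm_num) (by norm_num) hs.le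
  have hup : weight s r δ (η + ζ) ≤ 2 + 4 ^ s * (1 + ‖η‖ ^ 2) ^ s := by
    rcases lt_or_ge ‖η + ζ‖ 1 with h1 | h1
    · exact (weight_le_two hδ hr h1).trans (le_add_of_nonneg_right (by positivity))
    · rw [weight_of_ge h1, ← Real.mul_rpow (by norm_num) (by positivity)]
      have : (1 + ‖η + ζ‖ ^ 2) ^ s ≤ (4 * (1 + ‖η‖ ^ 2)) ^ s := by
        refine Real.rpow_le_rpow (by positivity) ?_ hs.le
        nlinarith [norm_nonneg (η + ζ)]
      linarith
  rcases lt_or_ge ‖η‖ 1 with h1 | h1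
  · have hlow : 1 ≤ 2 ^ (2 * δ - 2 * r) * weight s r δ η := by
      have hp : 0 < ‖η‖ := by linarith
      rw [weight_of_lt h1]
      calc (1 : ℝ) ≤ (2 * ‖η‖) ^ (2 * δ - 2 * r) :=
            Real.one_le_rpow (by linarith) (by linarith)
        _ = 2 ^ (2 * δ - 2 * r) * (‖η‖ ^ (2 * δ) / ‖η‖ ^ (2 * r)) := by
            rw [Real.mul_rpow (by norm_num) hp.le, Real.rpow_sub hp]
        _ ≤ _ := by
            gcongr
            linarith [sq_nonneg (η 0)]
    have h2 : 4 ^ s * (1 + ‖η‖ ^ 2) ^ s ≤ 8 ^ s := by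
      rw [← Real.mul_rpow (by norm_num) (by positivity)]
      refine Real.rpow_le_rpow (by positivity) ?_ hs.le
      nlinarith [norm_nonneg η]
    rw [mul_assoc]
    nlinarith
  · rw [weight_of_ge h1]
    have h2 : 1 ≤ (1 + ‖η‖ ^ 2) ^ s := Real.one_le_rpow (by nlinarith) hs.le
    calc weight s r δ (η + ζ) ≤ 2 + 4 ^ s * (1 + ‖η‖ ^ 2) ^ s := hup
      _ ≤ (2 + 8 ^ s) * 1 * (1 + ‖η‖ ^ 2) ^ s := by nlinarith
      _ ≤ _ := by gcongr

end

/-- A symmetric bound may be proved under the assumption `‖ζ‖ ≤ ‖η‖`. -/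
theorem forall_of_norm_le {d : ℕ} {P : Space d → Space d → Prop} (hP : ∀ η ζ, P η ζ → P ζ η)
    (h : ∀ η ζ, ‖ζ‖ ≤ ‖η‖ → P η ζ) (η ζ : Space d) : P η ζ := by
  rcases le_total ‖ζ‖ ‖η‖ with h1 | h1
  · exact h η ζ h1
  · exact hP ζ η (h ζ η h1)

/-! ### The exceptional interactions -/

section kernels

variable {d : ℕ} [NeZero d]

open Classical in
/-- The kernel of the exceptional interactions for `0 < r`: two comparable low frequencies `η`
and `ζ` produce a much lower frequency. -/
def highHighKernel (r δ a : ℝ) (η ζ : Space d) : ℝ :=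
  if 0 < ‖η‖ ∧ ‖η‖ ≤ 1 ∧ ‖η + ζ‖ ≤ ‖η‖ then
    ‖η + ζ‖ ^ (-(2 * r)) * |(η + ζ) 0| ^ a * (1 / (ζ 0 ^ 2 + (‖η‖ ^ δ) ^ 2)) *
      ‖η‖ ^ (4 * r - δ * a)
  else 0

open Classical in
/-- The kernel of the exceptional interactions for `r ≤ 0`: a low frequency `η` and a much lower
frequency `ζ`. -/
def highLowKernel (r δ : ℝ) (η ζ : Space d) : ℝ :=
  if 0 < ‖η + ζ‖ ∧ ‖η + ζ‖ ≤ 1 ∧ ‖ζ‖ ≤ 2 * ‖η + ζ‖ then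
    ‖ζ‖ ^ (2 * r) * (1 / (η 0 ^ 2 + (‖η + ζ‖ ^ δ) ^ 2))
  else 0

variable {s r δ a : ℝ}

theorem highHighKernel_nonneg (η ζ : Space d) : 0 ≤ highHighKernel r δ a η ζ := by
  unfold highHighKernel
  split_ifs <;> positivity

theorem highLowKernel_nonneg (η ζ : Space d) : 0 ≤ highLowKernel r δ η ζ := by
  unfold highLowKernel
  split_ifs <;> positivity

theorem measurable_highHighKernel :
    Measurable (Function.uncurry (highHighKernel (d := d) r δ a)) := by
  have h1 : Measurable fun p : Space d × Space d => ‖p.1‖ := by fun_prop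
  have h2 : Measurable fun p : Space d × Space d => ‖p.1 + p.2‖ := by fun_prop
  have h3 : Measurable fun p : Space d × Space d => (p.1 + p.2) 0 := by fun_prop
  have h4 : Measurable fun p : Space d × Space d => p.2 0 := by fun_prop
  refine Measurable.ite ?_ ?_ measurable_const
  · exact (measurableSet_lt measurable_const h1).inter
      ((measurableSet_le h1 measurable_const).inter (measurableSet_le h2 h1))
  · exact (((h2.pow_const _).mul ((continuous_abs.measurable.comp h3).pow_const _)).mul
      (((h4.pow_const 2).add ((h1.pow_const _).pow_const 2)).const_div 1)).mul (h1.pow_const _)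

theorem measurable_highLowKernel :
    Measurable (Function.uncurry (highLowKernel (d := d) r δ)) := by
  have h1 : Measurable fun p : Space d × Space d => ‖p.2‖ := by fun_prop
  have h2 : Measurable fun p : Space d × Space d => ‖p.1 + p.2‖ := by fun_prop
  have h4 : Measurable fun p : Space d × Space d => p.1 0 := by fun_prop
  refine Measurable.ite ?_ ?_ measurable_const
  · exact (measurableSet_lt measurable_const h2).inter
      ((measurableSet_le h2 measurable_const).inter (measurableSet_le h1 (h2.const_mul 2)))
  · exact (h1.pow_const _).mul
      (((h4.pow_const 2).add ((h2.pow_const _).pow_const 2)).const_div 1)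

/-- With ‖ζ‖ ≤ ‖η‖ by symmetry, three regions: ‖η‖ ≥ 1/2; ‖η‖ ≤ 2‖η + ζ‖; and ‖η + ζ‖ < ‖η‖ / 2,
which makes ‖η‖ and ‖ζ‖ comparable. Below 1/2 all three frequencies are in the unit ball. -/
theorem exists_weight_add_le_of_pos (hδ : 1 < δ) (hr0 : 0 < r) (hr : r ≤ 1) (hs : 0 < s)
    (ha : 0 ≤ a) (ha2 : a ≤ 2) :
    ∃ C : ℝ, 0 ≤ C ∧ ∀ η ζ : Space d, η ≠ 0 → ζ ≠ 0 →
      weight s r δ (η + ζ) ≤ C * (weight s r δ η + weight s r δ ζ +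
        weight s r δ η * weight s r δ ζ *
          (highHighKernel r δ a η ζ + highHighKernel r δ a ζ η)) := by
  have hδ0 : 0 < δ := by linarith
  set C₁ : ℝ := (2 + 8 ^ s) * 2 ^ (2 * δ - 2 * r)
  set C₂ : ℝ := (2 + 2 ^ (2 * δ)) * 2 ^ (2 * r)
  set C₃ : ℝ := 4 * 2 ^ (2 * δ) * 2 ^ (2 * r)
  have hC₁ : 0 ≤ C₁ := by positivity
  have hC₂ : 0 ≤ C₂ := by positivity
  have hC₃ : 0 ≤ C₃ := by positivity
  refine ⟨C₁ + C₂ + C₃, by positivity, ?_⟩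
  refine forall_of_norm_le (fun η ζ h hζ hη => ?_) fun η ζ hle hη hζ => ?_
  · have := h hη hζ
    rw [add_comm η ζ] at this
    refine this.trans (le_of_eq ?_)
    ring
  have w1 := weight_pos (s := s) (r := r) (δ := δ) hη
  have w2 := weight_pos (s := s) (r := r) (δ := δ) hζ
  have k1 := highHighKernel_nonneg (r := r) (δ := δ) (a := a) η ζ
  have k2 := highHighKernel_nonneg (r := r) (δ := δ) (a := a) ζ η
  have n1 : 0 ≤ weight s r δ η * weight s r δ ζ * highHighKernel r δ a η ζ := by positivity
  have n2 : 0 ≤ weight s r δ η * weight s r δ ζ * highHighKernel r δ a ζ η := by positivity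
  set S := weight s r δ η + weight s r δ ζ + weight s r δ η * weight s r δ ζ *
    (highHighKernel r δ a η ζ + highHighKernel r δ a ζ η) with hS
  have hS0 : 0 ≤ S := by positivity
  have fin : ∀ {C T : ℝ}, 0 ≤ C → C ≤ C₁ + C₂ + C₃ → T ≤ S → weight s r δ (η + ζ) ≤ C * T →
      weight s r δ (η + ζ) ≤ (C₁ + C₂ + C₃) * S := fun hC hC' hT h =>
    (h.trans (mul_le_mul_of_nonneg_left hT hC)).trans (mul_le_mul_of_nonneg_right hC' hS0)
  rcases le_or_gt (1 / 2) ‖η‖ with hbig | hsmall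
  · exact fin (C := C₁) (T := weight s r δ η) hC₁ (by linarith) (by rw [hS]; linarith)
      (weight_add_le_of_half_le hδ hr hs hle hbig)
  rcases eq_or_ne (η + ζ) 0 with hz | hz
  · rw [hz, weight_zero hδ0]
    positivity
  have hp : 0 < ‖η‖ := norm_pos_iff.2 hη
  have hq : 0 < ‖ζ‖ := norm_pos_iff.2 hζ
  have hm : 0 < ‖η + ζ‖ := norm_pos_iff.2 hz
  have hadd := norm_add_le η ζ
  have hpm : ‖η‖ ≤ ‖η + ζ‖ + ‖ζ‖ := by
    simpa using norm_sub_le (η + ζ) ζ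
  have hcoord : (η + ζ) 0 = η 0 + ζ 0 := rfl
  have e0 : weight s r δ (η + ζ) = lowWeight r δ (η 0 + ζ 0) ‖η + ζ‖ :=
    weight_eq_lowWeight (by linarith)
  have e1 : weight s r δ η = lowWeight r δ (η 0) ‖η‖ := weight_eq_lowWeight (by linarith)
  have e2 : weight s r δ ζ = lowWeight r δ (ζ 0) ‖ζ‖ := weight_eq_lowWeight (by linarith)
  rcases le_or_gt ‖η‖ (2 * ‖η + ζ‖) with hA | hA
  · refine fin (C := C₂) (T := weight s r δ η + weight s r δ ζ) hC₂ (by linarith)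
      (by rw [hS]; linarith) ?_
    rw [e0, e1, e2]
    exact lowWeight_add_le_of_half_le hδ0 hr0 hp hq hm hle (by linarith) hA
  -- The input with the larger first coordinate plays the role of t₁, so the kernel appears in
  -- either order.
  · rcases le_total |ζ 0| |η 0| with ht | ht
    · refine fin (C := C₃) (T := weight s r δ η + weight s r δ η * weight s r δ ζ *
        highHighKernel r δ a η ζ) hC₃ (by linarith) (by rw [hS]; linarith) ?_
      rw [e0, e1, e2, highHighKernel, if_pos ⟨hp, by linarith, by linarith⟩, hcoord]
      exact lowWeight_add_le_of_comparable hδ0 hr0 (by linarith) ha ha2 hp hq hm (by linarith)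
        (by linarith) (by linarith) ht
    · refine fin (C := C₃) (T := weight s r δ ζ + weight s r δ ζ * weight s r δ η *
        highHighKernel r δ a ζ η) hC₃ (by linarith) (by rw [hS]; linarith) ?_
      rw [e0, e1, e2, highHighKernel, add_comm ζ η, if_pos ⟨hq, by linarith, by linarith⟩,
        hcoord, add_comm (η 0)]
      exact lowWeight_add_le_of_comparable hδ0 hr0 (by linarith) ha ha2 hq hp hm (by linarith)
        (by linarith) (by linarith) ht

theorem exists_weight_add_le_of_nonpos (hδ : 1 < δ) (hr : r ≤ 0) (hs : 0 < s) :
    ∃ C : ℝ, 0 ≤ C ∧ ∀ η ζ : Space d, η ≠ 0 → ζ ≠ 0 →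
      weight s r δ (η + ζ) ≤ C * (weight s r δ η + weight s r δ ζ +
        weight s r δ η * weight s r δ ζ * (highLowKernel r δ η ζ + highLowKernel r δ ζ η)) := by
  have hδ0 : 0 < δ := by linarith
  set C₁ : ℝ := (2 + 8 ^ s) * 2 ^ (2 * δ - 2 * r)
  set C₂ : ℝ := (2 + 2 ^ (2 * δ)) * 2 ^ (-(2 * r)) * (2 ^ (2 * δ) + 2 ^ (-(2 * r)))
  have hC₁ : 0 ≤ C₁ := by positivity
  have hC₂ : 0 ≤ C₂ := by positivity
  refine ⟨C₁ + C₂, by positivity, ?_⟩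
  refine forall_of_norm_le (fun η ζ h hζ hη => ?_) fun η ζ hle hη hζ => ?_
  · have := h hη hζ
    rw [add_comm η ζ] at this
    refine this.trans (le_of_eq ?_)
    ring
  have w1 := weight_pos (s := s) (r := r) (δ := δ) hη
  have w2 := weight_pos (s := s) (r := r) (δ := δ) hζ
  have k1 := highLowKernel_nonneg (r := r) (δ := δ) η ζ
  have k2 := highLowKernel_nonneg (r := r) (δ := δ) ζ η
  have n1 : 0 ≤ weight s r δ η * weight s r δ ζ * highLowKernel r δ η ζ := by positivity
  have n2 : 0 ≤ weight s r δ η * weight s r δ ζ * highLowKernel r δ ζ η := by positivity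
  set S := weight s r δ η + weight s r δ ζ + weight s r δ η * weight s r δ ζ *
    (highLowKernel r δ η ζ + highLowKernel r δ ζ η) with hS
  have hS0 : 0 ≤ S := by positivity
  have fin : ∀ {C T : ℝ}, 0 ≤ C → C ≤ C₁ + C₂ → T ≤ S → weight s r δ (η + ζ) ≤ C * T →
      weight s r δ (η + ζ) ≤ (C₁ + C₂) * S := fun hC hC' hT h =>
    (h.trans (mul_le_mul_of_nonneg_left hT hC)).trans (mul_le_mul_of_nonneg_right hC' hS0)
  rcases le_or_gt (1 / 2) ‖η‖ with hbig | hsmall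
  · exact fin (C := C₁) (T := weight s r δ η) hC₁ (by linarith) (by rw [hS]; linarith)
      (weight_add_le_of_half_le hδ (by linarith) hs hle hbig)
  rcases eq_or_ne (η + ζ) 0 with hz | hz
  · rw [hz, weight_zero hδ0]
    positivity
  have hp : 0 < ‖η‖ := norm_pos_iff.2 hη
  have hq : 0 < ‖ζ‖ := norm_pos_iff.2 hζ
  have hm : 0 < ‖η + ζ‖ := norm_pos_iff.2 hz
  have hadd := norm_add_le η ζ
  have hpm : ‖η‖ ≤ ‖η + ζ‖ + ‖ζ‖ := by
    simpa using norm_sub_le (η + ζ) ζ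
  have e0 : weight s r δ (η + ζ) = lowWeight r δ (η 0 + ζ 0) ‖η + ζ‖ :=
    weight_eq_lowWeight (by linarith)
  have e1 : weight s r δ η = lowWeight r δ (η 0) ‖η‖ := weight_eq_lowWeight (by linarith)
  have e2 : weight s r δ ζ = lowWeight r δ (ζ 0) ‖ζ‖ := weight_eq_lowWeight (by linarith)
  refine fin (C := C₂) (T := weight s r δ η + weight s r δ ζ +
    weight s r δ η * weight s r δ ζ * highLowKernel r δ η ζ) hC₂ (by linarith)
    (by rw [hS]; linarith) ?_
  rw [e0, e1, e2, highLowKernel]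
  have h := lowWeight_add_le_of_nonpos (t₁ := η 0) (t₂ := ζ 0) hδ0 hr hp hq hm (by linarith) hpm
  refine h.trans (le_of_eq ?_)
  congr 3
  by_cases hc : ‖ζ‖ ≤ 2 * ‖η + ζ‖
  · rw [if_pos hc, if_pos ⟨hm, by linarith, hc⟩]
  · rw [if_neg hc, if_neg fun h => hc h.2.2]

end kernels

/-! ### Integrals of the exceptional kernels -/

section kernelIntegrals

variable {n : ℕ} {r δ a : ℝ}

/-- In the variable x = η + ζ the kernel is the integrand of `SliceBound.lintegral_le` with R = ‖η‖,
A = ‖η‖^δ and c = η 0. The powers of ‖η‖ add up to the exponent in `hexp`, and ‖η‖ ≤ 1. -/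
theorem exists_lintegral_highHighKernel_le (hr : 0 ≤ r) (h : SliceBound n r a)
    (hexp : 0 ≤ n + 2 * r - δ - a * (δ - 1)) :
    ∃ C : ℝ≥0∞, C ≠ ⊤ ∧ ∀ η : Space (n + 1),
      ∫⁻ ζ, ENNReal.ofReal (highHighKernel r δ a η ζ) ≤ C := by
  obtain ⟨C, hC, hI⟩ := h.lintegral_le hr
  refine ⟨C, hC, fun η => ?_⟩
  rw [← lintegral_sub_right_eq_self _ η]
  by_cases hη : 0 < ‖η‖ ∧ ‖η‖ ≤ 1
  · have h1 := hI ‖η‖ (‖η‖ ^ δ) (η 0) hη.1 (by have := hη.1; positivity)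
    calc _ ≤ ∫⁻ x : Space (n + 1), (closedBall (0 : Space (n + 1)) ‖η‖).indicator
          (fun x => ENNReal.ofReal (‖x‖ ^ (-(2 * r)) * |x 0| ^ a *
            (1 / ((x 0 - η 0) ^ 2 + (‖η‖ ^ δ) ^ 2)))) x *
              ENNReal.ofReal (‖η‖ ^ (4 * r - δ * a)) := by
          refine lintegral_mono fun x => ?_
          rw [highHighKernel, add_sub_cancel]
          by_cases hx : ‖x‖ ≤ ‖η‖
          · rw [if_pos ⟨hη.1, hη.2, hx⟩, Set.indicator_of_mem (by simpa using hx),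
              ← ENNReal.ofReal_mul (by positivity)]
            rfl
          · rw [if_neg fun h => hx h.2.2]
            simp
      _ ≤ C * ENNReal.ofReal (‖η‖ ^ (n - 2 * r + a) * (1 / ‖η‖ ^ δ)) *
            ENNReal.ofReal (‖η‖ ^ (4 * r - δ * a)) := by
          rw [lintegral_mul_const' _ _ ENNReal.ofReal_ne_top]
          gcongr
      _ ≤ C * 1 := by
          rw [mul_assoc, ← ENNReal.ofReal_mul (by positivity), ← ENNReal.ofReal_one]
          gcongr
          rw [one_div, ← Real.rpow_neg hη.1.le, ← Real.rpow_add hη.1, ← Real.rpow_add hη.1]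
          exact Real.rpow_le_one hη.1.le hη.2 (by linarith)
      _ = C := mul_one C
  · have : ∀ x, highHighKernel r δ a η (x - η) = 0 := fun x => by
      rw [highHighKernel, if_neg fun h => hη ⟨h.1, h.2.1⟩]
    simp [this]

/-- The same model integral in the variable ζ = ξ - η, now at fixed output ξ, with R = 2‖ξ‖, A =
‖ξ‖^δ and a = 0. -/
theorem exists_lintegral_highLowKernel_le (hr : r ≤ 0) (h : SliceBound n (-r) 0)
    (hexp : 0 ≤ n + 2 * r - δ) :
    ∃ C : ℝ≥0∞, C ≠ ⊤ ∧ ∀ ξ : Space (n + 1),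
      ∫⁻ η, ENNReal.ofReal (highLowKernel r δ η (ξ - η)) ≤ C := by
  obtain ⟨C, hC, hI⟩ := h.lintegral_le (by linarith)
  refine ⟨C * ENNReal.ofReal (2 ^ (n + 2 * r)), ENNReal.mul_ne_top hC ENNReal.ofReal_ne_top,
    fun ξ => ?_⟩
  rw [← lintegral_sub_left_eq_self _ ξ]
  by_cases hξ : 0 < ‖ξ‖ ∧ ‖ξ‖ ≤ 1
  · have h1 := hI (2 * ‖ξ‖) (‖ξ‖ ^ δ) (ξ 0) (by linarith) (by have := hξ.1; positivity)
    calc _ ≤ ∫⁻ x : Space (n + 1), (closedBall (0 : Space (n + 1)) (2 * ‖ξ‖)).indicator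
          (fun x => ENNReal.ofReal (‖x‖ ^ (-(2 * -r)) * |x 0| ^ (0 : ℝ) *
            (1 / ((x 0 - ξ 0) ^ 2 + (‖ξ‖ ^ δ) ^ 2)))) x := by
          refine lintegral_mono fun x => ?_
          rw [highLowKernel, sub_sub_cancel, sub_add_cancel]
          by_cases hx : ‖x‖ ≤ 2 * ‖ξ‖
          · rw [if_pos ⟨hξ.1, hξ.2, hx⟩, Set.indicator_of_mem (by simpa using hx),
              Real.rpow_zero, mul_one, mul_neg, neg_neg, PiLp.sub_apply, sub_sq_comm]
          · rw [if_neg fun h => hx h.2.2]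
            simp
      _ ≤ C * ENNReal.ofReal ((2 * ‖ξ‖) ^ (n - 2 * -r + 0) * (1 / ‖ξ‖ ^ δ)) := h1
      _ ≤ C * ENNReal.ofReal (2 ^ (n + 2 * r)) := by
          gcongr
          rw [one_div, ← Real.rpow_neg hξ.1.le, Real.mul_rpow (by norm_num) hξ.1.le, mul_assoc,
            ← Real.rpow_add hξ.1, show (n : ℝ) - 2 * -r + 0 = n + 2 * r by ring]
          exact mul_le_of_le_one_right (by positivity)
            (Real.rpow_le_one hξ.1.le hξ.2 (by linarith))
  · have : ∀ x, highLowKernel r δ (ξ - x) (ξ - (ξ - x)) = 0 := fun x => by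
      rw [highLowKernel, if_neg fun h => hξ ?_]
      rw [sub_sub_cancel, sub_add_cancel] at h
      exact ⟨h.1, h.2.1⟩
    simp only [this, ENNReal.ofReal_zero, lintegral_zero, zero_le]

end kernelIntegrals

/-! ### The algebra property -/

theorem measurable_uncurry_swap {d : ℕ} {κ : Space d → Space d → ℝ}
    (h : Measurable (Function.uncurry κ)) :
    Measurable (Function.uncurry fun η ζ => κ ζ η) := h.comp measurable_swap

theorem measurable_uncurry_add {d : ℕ} {κ κ' : Space d → Space d → ℝ}
    (h : Measurable (Function.uncurry κ)) (h' : Measurable (Function.uncurry κ')) :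
    Measurable (Function.uncurry fun η ζ => κ η ζ + κ' η ζ) := h.add h'

section

variable {d : ℕ} [NeZero d] {s r δ : ℝ}

/-- Schur-type bounds for the quotient `W (η + ζ) / (W η * W ζ)` give a bilinear estimate for the
energy of a convolution. -/
theorem energy_conv_le {K₁ K₂ K₃ : Space d → Space d → ℝ≥0∞}
    (m₁ : Measurable (Function.uncurry K₁)) (m₂ : Measurable (Function.uncurry K₂))
    (m₃ : Measurable (Function.uncurry K₃)) {C : ℝ≥0∞}
    (h₁ : ∀ ζ, ∫⁻ η, K₁ η ζ ≤ C) (h₂ : ∀ η, ∫⁻ ζ, K₂ η ζ ≤ C)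
    (h₃ : ∀ ξ, ∫⁻ η, K₃ η (ξ - η) ≤ C)
    (hK : ∀ η ζ : Space d, η ≠ 0 → ζ ≠ 0 → ENNReal.ofReal (weight s r δ (η + ζ)) ≤
      ENNReal.ofReal (weight s r δ η) * ENNReal.ofReal (weight s r δ ζ) *
        (K₁ η ζ + K₂ η ζ + K₃ η ζ))
    {F G : Space d → ℂ} (hF : AEStronglyMeasurable F) (hG : AEStronglyMeasurable G) :
    energy s r δ (conv F G) ≤ 9 * C * energy s r δ F * energy s r δ G := by
  have hconv : conv F G = conv (hF.mk F) (hG.mk G) := by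
    ext ξ
    refine integral_congr_ae ?_
    have h := (quasiMeasurePreserving_sub_left volume ξ).ae_eq_comp hG.ae_eq_mk
    filter_upwards [hF.ae_eq_mk, h] with η h1 h2
    rw [h1, show G (ξ - η) = hG.mk G (ξ - η) from h2]
  rw [hconv, energy_congr s r δ hF.ae_eq_mk, energy_congr s r δ hG.ae_eq_mk]
  refine le_trans (lintegral_mono fun ξ => ?_) (lintegral_conv_sq_le
    (measurable_weight s r δ).ennreal_ofReal m₁ m₂ m₃ h₁ h₂ h₃ hK
    hF.stronglyMeasurable_mk.measurable.enorm hG.stronglyMeasurable_mk.measurable.enorm)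
  gcongr
  refine (enorm_integral_le_lintegral_enorm _).trans (le_of_eq ?_)
  exact lintegral_congr fun η => enorm_mul _ _

/-- Divided by W(η) W(ζ), the terms W(η) and W(ζ) become 1/W(ζ) and 1/W(η). These are integrable, so
they join the second and the first kernel. -/
theorem exists_energy_conv_le {κ₁ κ₂ κ₃ : Space d → Space d → ℝ}
    (m₁ : Measurable (Function.uncurry κ₁)) (m₂ : Measurable (Function.uncurry κ₂))
    (m₃ : Measurable (Function.uncurry κ₃)) (n₁ : ∀ η ζ, 0 ≤ κ₁ η ζ) (n₂ : ∀ η ζ, 0 ≤ κ₂ η ζ)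
    (n₃ : ∀ η ζ, 0 ≤ κ₃ η ζ) {B : ℝ≥0∞} (hB : B ≠ ⊤)
    (h₁ : ∀ ζ, ∫⁻ η, ENNReal.ofReal (κ₁ η ζ) ≤ B) (h₂ : ∀ η, ∫⁻ ζ, ENNReal.ofReal (κ₂ η ζ) ≤ B)
    (h₃ : ∀ ξ, ∫⁻ η, ENNReal.ofReal (κ₃ η (ξ - η)) ≤ B) {C : ℝ} (hC : 0 ≤ C)
    (hw : ∀ η ζ : Space d, η ≠ 0 → ζ ≠ 0 → weight s r δ (η + ζ) ≤
      C * (weight s r δ η + weight s r δ ζ +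
        weight s r δ η * weight s r δ ζ * (κ₁ η ζ + κ₂ η ζ + κ₃ η ζ)))
    (hint : ∫⁻ ξ : Space d, ENNReal.ofReal (weight s r δ ξ)⁻¹ < ⊤) :
    ∃ C' : ℝ≥0∞, C' ≠ ⊤ ∧ ∀ F G : Space d → ℂ, Integrable F → Integrable G →
      energy s r δ (conv F G) ≤ C' * energy s r δ F * energy s r δ G := by
  let v : Space d → ℝ≥0∞ := fun ξ => ENNReal.ofReal (weight s r δ ξ)⁻¹
  have mv : Measurable v := (measurable_weight s r δ).inv.ennreal_ofReal
  let D : ℝ≥0∞ := ENNReal.ofReal C * ((∫⁻ ξ, v ξ) + B)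
  have hD : D ≠ ⊤ := ENNReal.mul_ne_top ENNReal.ofReal_ne_top (ENNReal.add_ne_top.2 ⟨hint.ne, hB⟩)
  have mr₁ : ∀ ζ, Measurable fun η => ENNReal.ofReal (κ₁ η ζ) := fun ζ =>
    (m₁.comp (by fun_prop : Measurable fun η : Space d => (η, ζ))).ennreal_ofReal
  have b₁ : ∀ ζ, ∫⁻ η, ENNReal.ofReal C * (v η + ENNReal.ofReal (κ₁ η ζ)) ≤ D := fun ζ => by
    rw [lintegral_const_mul' _ _ ENNReal.ofReal_ne_top, lintegral_add_left mv]
    exact mul_le_mul_right (add_le_add_right (h₁ ζ) _) _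
  have b₂ : ∀ η, ∫⁻ ζ, ENNReal.ofReal C * (v ζ + ENNReal.ofReal (κ₂ η ζ)) ≤ D := fun η => by
    rw [lintegral_const_mul' _ _ ENNReal.ofReal_ne_top, lintegral_add_left mv]
    exact mul_le_mul_right (add_le_add_right (h₂ η) _) _
  have b₃ : ∀ ξ, ∫⁻ η, ENNReal.ofReal C * ENNReal.ofReal (κ₃ η (ξ - η)) ≤ D := fun ξ => by
    rw [lintegral_const_mul' _ _ ENNReal.ofReal_ne_top]
    exact mul_le_mul_right ((h₃ ξ).trans le_add_self) _
  refine ⟨9 * D, ENNReal.mul_ne_top (by norm_num) hD, fun F G hF hG => ?_⟩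
  refine energy_conv_le (((mv.comp measurable_fst).add m₁.ennreal_ofReal).const_mul _)
    (((mv.comp measurable_snd).add m₂.ennreal_ofReal).const_mul _)
    (K₃ := fun η ζ => ENNReal.ofReal C * ENNReal.ofReal (κ₃ η ζ))
    (m₃.ennreal_ofReal.const_mul _) b₁ b₂ b₃ (fun η ζ hη hζ => ?_) hF.1 hG.1
  have w1 := weight_pos (s := s) (r := r) (δ := δ) hη
  have w2 := weight_pos (s := s) (r := r) (δ := δ) hζ
  have k1 := n₁ η ζ
  have k2 := n₂ η ζ
  have k3 := n₃ η ζ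
  have i1 := inv_pos.2 w1
  have i2 := inv_pos.2 w2
  simp only [v]
  rw [← ENNReal.ofReal_add i1.le k1, ← ENNReal.ofReal_add i2.le k2, ← ENNReal.ofReal_mul hC,
    ← ENNReal.ofReal_mul hC, ← ENNReal.ofReal_mul hC, ← ENNReal.ofReal_mul w1.le,
    ← ENNReal.ofReal_add (by positivity) (by positivity),
    ← ENNReal.ofReal_add (by positivity) (by positivity), ← ENNReal.ofReal_mul (by positivity)]
  refine ENNReal.ofReal_le_ofReal ((hw η ζ hη hζ).trans (le_of_eq ?_))
  generalize weight s r δ η = x at *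
  generalize weight s r δ ζ = y at *
  field_simp
  ring

end

section

variable {n : ℕ} {s r δ : ℝ}

theorem exists_energy_conv_le_of_pos {a : ℝ} (hδ : 1 < δ) (hr0 : 0 < r) (hr : r ≤ 1)
    (hs : 0 < s) (ha : 0 ≤ a) (ha2 : a ≤ 2) (h : SliceBound n r a)
    (hexp : 0 ≤ n + 2 * r - δ - a * (δ - 1))
    (hint : ∫⁻ ξ : Space (n + 1), ENNReal.ofReal (weight s r δ ξ)⁻¹ < ⊤) :
    ∃ C : ℝ≥0∞, C ≠ ⊤ ∧ ∀ F G : Space (n + 1) → ℂ, Integrable F → Integrable G →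
      energy s r δ (conv F G) ≤ C * energy s r δ F * energy s r δ G := by
  obtain ⟨C, hC0, hC⟩ := exists_weight_add_le_of_pos (d := n + 1) hδ hr0 hr hs ha ha2
  obtain ⟨B, hB, hk⟩ := exists_lintegral_highHighKernel_le hr0.le h hexp
  refine exists_energy_conv_le (κ₁ := fun η ζ => highHighKernel r δ a ζ η)
    (κ₂ := highHighKernel r δ a) (κ₃ := fun _ _ => 0)
    (measurable_uncurry_swap measurable_highHighKernel) measurable_highHighKernel measurable_const
    (fun η ζ => highHighKernel_nonneg ζ η) highHighKernel_nonneg (fun _ _ => le_rfl) hB hk hk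
    (fun ξ => by simp) hC0 (fun η ζ hη hζ => (hC η ζ hη hζ).trans (le_of_eq ?_)) hint
  ring

theorem exists_energy_conv_le_of_nonpos (hδ : 1 < δ) (hr : r ≤ 0) (hs : 0 < s)
    (h : SliceBound n (-r) 0) (hexp : 0 ≤ n + 2 * r - δ)
    (hint : ∫⁻ ξ : Space (n + 1), ENNReal.ofReal (weight s r δ ξ)⁻¹ < ⊤) :
    ∃ C : ℝ≥0∞, C ≠ ⊤ ∧ ∀ F G : Space (n + 1) → ℂ, Integrable F → Integrable G →
      energy s r δ (conv F G) ≤ C * energy s r δ F * energy s r δ G := by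
  obtain ⟨C, hC0, hC⟩ := exists_weight_add_le_of_nonpos (d := n + 1) hδ hr hs
  obtain ⟨B, hB, hk⟩ := exists_lintegral_highLowKernel_le hr h hexp
  have hk' : ∀ ξ : Space (n + 1),
      ∫⁻ η, ENNReal.ofReal (highLowKernel r δ (ξ - η) η) ≤ B := fun ξ => by
    rw [← lintegral_sub_left_eq_self _ ξ]
    simpa only [sub_sub_cancel] using hk ξ
  refine exists_energy_conv_le (κ₁ := fun _ _ => 0) (κ₂ := fun _ _ => 0)
    (κ₃ := fun η ζ => highLowKernel r δ η ζ + highLowKernel r δ ζ η) (B := B + B)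
    measurable_const measurable_const
    (measurable_uncurry_add measurable_highLowKernel
      (measurable_uncurry_swap measurable_highLowKernel))
    (fun _ _ => le_rfl) (fun _ _ => le_rfl)
    (fun η ζ => add_nonneg (highLowKernel_nonneg η ζ) (highLowKernel_nonneg ζ η))
    (ENNReal.add_ne_top.2 ⟨hB, hB⟩) (fun _ => by simp) (fun _ => by simp) (fun ξ => ?_) hC0
    (fun η ζ hη hζ => (hC η ζ hη hζ).trans (le_of_eq ?_)) hint
  · have m : Measurable fun η => ENNReal.ofReal (highLowKernel r δ η (ξ - η)) :=
      (measurable_highLowKernel.comp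
        (by fun_prop : Measurable fun η : Space (n + 1) => (η, ξ - η))).ennreal_ofReal
    simp only [ENNReal.ofReal_add (highLowKernel_nonneg _ _) (highLowKernel_nonneg _ _)]
    rw [lintegral_add_left m]
    exact add_le_add (hk ξ) (hk' ξ)
  · ring

theorem boundedMul (hn : 0 < n) (hδ : 1 < δ) (hd : δ - 2 * r < n) (hr : r ≤ 1)
    (hs : ((n + 1 : ℕ) : ℝ) / 2 < s) (hcase : 2 ≤ n ∨ δ ≤ 2) :
    BoundedMul (d := n + 1) (X (n + 1) s r δ) (xNorm s r δ) ∧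
      BoundedMul (d := n + 1) (XReal (n + 1) s r δ) (xNorm s r δ) := by
  have hint := lintegral_inv_weight_lt_top hn (by linarith) hd hs
  have hs0 : 0 < s := lt_of_le_of_lt (by positivity) hs
  have hn1 : (1 : ℝ) ≤ n := by exact_mod_cast hn
  suffices h : ∃ C : ℝ≥0∞, C ≠ ⊤ ∧ ∀ F G : Space (n + 1) → ℂ, Integrable F → Integrable G →
      energy s r δ (conv F G) ≤ C * energy s r δ F * energy s r δ G by
    obtain ⟨C, hC, h⟩ := h
    exact boundedMul_of_energy_conv_le hC (fun w hw => integrable_of_energy_lt_top hint hw) h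
  rcases le_or_gt r 0 with hr0 | hr0
  · exact exists_energy_conv_le_of_nonpos hδ hr0 hs0
      (sliceBound_of_lt hn le_rfl (by linarith) (by linarith)) (by linarith) hint
  · obtain ⟨a, ha0, ha2, hS, hexp⟩ : ∃ a : ℝ, 0 ≤ a ∧ a ≤ 2 ∧ SliceBound n r a ∧
        0 ≤ n + 2 * r - δ - a * (δ - 1) := by
      -- The choice of a makes |x|^(-2r) |x 0|^a integrable over slices: nothing is needed for 2r <
      -- n, any positive a for 2r = n, and a = 2r - n for 2r > n.
      rcases lt_trichotomy (2 * r) n with h | h | h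
      · exact ⟨0, le_rfl, by norm_num, sliceBound_of_lt hn le_rfl (by linarith) (by linarith),
          by linarith⟩
      -- The first entry meets the slice bound's a ≤ 2r, the second the exponent condition.
      · set a := min (2 * r) ((n + 2 * r - δ) / (δ - 1)) with ha
        have h1 : 0 < a := lt_min (by linarith) (div_pos (by linarith) (by linarith))
        have h2 : a ≤ 2 * r := min_le_left _ _
        have h3 : a * (δ - 1) ≤ n + 2 * r - δ := by
          rw [← le_div_iff₀ (by linarith)]
          exact min_le_right _ _
        exact ⟨a, h1.le, by linarith, sliceBound_of_lt hn h1.le h2 (by linarith), by linarith⟩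
      · have hn2 : n = 1 := by
          have : (n : ℝ) < 2 := by linarith
          have : n < 2 := by exact_mod_cast this
          omega
        have hδ2 : δ ≤ 2 := hcase.resolve_left (by omega)
        -- For n = 1 the remaining exponent equals 2r(2 - δ).
        refine ⟨2 * r - n, by linarith, by linarith, sliceBound_of_gt h, ?_⟩
        subst hn2
        push_cast
        nlinarith [mul_nonneg hr0.le (sub_nonneg.2 hδ2)]
    exact exists_energy_conv_le_of_pos hδ hr0 hr hs0 ha0 ha2 hS hexp hint

end

/-! ### The counterexample in the plane for δ > 2 -/

theorem lintegral_space_two {g : ℝ → ℝ → ℝ≥0∞} (hg : Measurable (Function.uncurry g)) :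
    ∫⁻ x : Space 2, g (x 0) (x 1) = ∫⁻ u, ∫⁻ t, g t u := by
  have hg' : Measurable (Function.uncurry fun (t : ℝ) (y : Fin 1 → ℝ) => g t (y 0)) :=
    hg.comp (measurable_fst.prodMk ((measurable_pi_apply 0).comp measurable_snd))
  have h := lintegral_space_succ hg'
  have h1 : ∀ t : ℝ, ∫⁻ y : Fin 1 → ℝ, g t (y 0) = ∫⁻ u, g t u := fun t =>
    (volume_preserving_funUnique (Fin 1) ℝ).lintegral_comp
      (hg.comp measurable_prodMk_left : Measurable fun u => g t u)
  simp only [h1] at h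
  rw [lintegral_lintegral_swap hg.aemeasurable] at h
  exact h

theorem norm_sq_two (x : Space 2) : ‖x‖ ^ 2 = x 0 ^ 2 + x 1 ^ 2 := by
  rw [EuclideanSpace.real_norm_sq_eq, Fin.sum_univ_two]

theorem volume_box {a b c d : ℝ} :
    volume {x : Space 2 | x 0 ∈ Set.Icc a b ∧ x 1 ∈ Set.Icc c d} =
      ENNReal.ofReal (d - c) * ENNReal.ofReal (b - a) := by
  have mx : MeasurableSet {x : Space 2 | x 0 ∈ Set.Icc a b ∧ x 1 ∈ Set.Icc c d} :=
    ((by fun_prop : Measurable fun x : Space 2 => x 0) measurableSet_Icc).inter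
      ((by fun_prop : Measurable fun x : Space 2 => x 1) measurableSet_Icc)
  have mg : Measurable (Function.uncurry fun t u : ℝ =>
      (Set.Icc c d).indicator (1 : ℝ → ℝ≥0∞) u * (Set.Icc a b).indicator (1 : ℝ → ℝ≥0∞) t) :=
    ((measurable_one.indicator measurableSet_Icc).comp measurable_snd).mul
      ((measurable_one.indicator measurableSet_Icc).comp measurable_fst)
  have h := lintegral_space_two mg
  rw [← lintegral_indicator_one mx]
  calc _ = ∫⁻ x : Space 2, (Set.Icc c d).indicator (1 : ℝ → ℝ≥0∞) (x 1) *
        (Set.Icc a b).indicator (1 : ℝ → ℝ≥0∞) (x 0) := by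
        refine lintegral_congr fun x => ?_
        by_cases h0 : x 0 ∈ Set.Icc a b
        · by_cases h1 : x 1 ∈ Set.Icc c d
          · rw [Set.indicator_of_mem h0, Set.indicator_of_mem h1,
              Set.indicator_of_mem (by exact ⟨h0, h1⟩)]
            simp
          · rw [Set.indicator_of_notMem h1, Set.indicator_of_notMem fun h => h1 h.2, zero_mul]
        · rw [Set.indicator_of_notMem h0, Set.indicator_of_notMem fun h => h0 h.1, mul_zero]
    _ = _ := by
        rw [h]
        have : ∀ u : ℝ, ∫⁻ t, (Set.Icc c d).indicator (1 : ℝ → ℝ≥0∞) u *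
            (Set.Icc a b).indicator (1 : ℝ → ℝ≥0∞) t =
            (Set.Icc c d).indicator (1 : ℝ → ℝ≥0∞) u * ENNReal.ofReal (b - a) := fun u => by
          rw [lintegral_const_mul _ (measurable_one.indicator measurableSet_Icc),
            lintegral_indicator_one measurableSet_Icc, Real.volume_Icc]
        simp only [this]
        rw [lintegral_mul_const _ (measurable_one.indicator measurableSet_Icc),
          lintegral_indicator_one measurableSet_Icc, Real.volume_Icc]

/-- Only almost everywhere: where the integrand is not integrable, the Bochner integral is 0 while
the right side is infinite. -/
theorem ae_enorm_conv_ofReal {d : ℕ} {f : Space d → ℝ} (hf : Integrable f) (h0 : ∀ ξ, 0 ≤ f ξ) :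
    ∀ᵐ ξ, ‖conv (fun η => (f η : ℂ)) (fun η => (f η : ℂ)) ξ‖ₑ =
      ∫⁻ η, ENNReal.ofReal (f η * f (ξ - η)) := by
  filter_upwards [hf.ae_convolution_exists (ContinuousLinearMap.mul ℝ ℝ) hf] with ξ hξ
  have hi : Integrable fun η => f η * f (ξ - η) := hξ
  have h1 : conv (fun η => (f η : ℂ)) (fun η => (f η : ℂ)) ξ =
      ((∫ η, f η * f (ξ - η) : ℝ) : ℂ) := by
    rw [conv, ← integral_complex_ofReal]
    simp only [Complex.ofReal_mul]
  have hnn : ∀ η, 0 ≤ f η * f (ξ - η) := fun η => mul_nonneg (h0 _) (h0 _)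
  rw [h1, ← ofReal_integral_eq_lintegral_ofReal hi (Eventually.of_forall hnn),
    ← ofReal_norm, Complex.norm_real,
    Real.norm_of_nonneg (integral_nonneg hnn)]

open Classical in
/-- A function concentrated near the hyperplane `ξ₁ = 0`, singular at the origin. -/
def cusp (δ β : ℝ) (η : Space 2) : ℝ :=
  if |η 0| ≤ |η 1| ^ δ ∧ 0 < |η 1| ∧ |η 1| < 1 / 2 then |η 1| ^ (-β) else 0

section cusp

variable {s r δ β : ℝ}

theorem cusp_nonneg (η : Space 2) : 0 ≤ cusp δ β η := by
  unfold cusp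
  split_ifs <;> positivity

theorem cusp_neg (η : Space 2) : cusp δ β (-η) = cusp δ β η := by
  simp only [cusp, PiLp.neg_apply, abs_neg]

theorem measurable_cusp : Measurable (cusp δ β) := by
  have h0 : Measurable fun x : Space 2 => |x 0| :=
    continuous_abs.measurable.comp (by fun_prop)
  have h1 : Measurable fun x : Space 2 => |x 1| :=
    continuous_abs.measurable.comp (by fun_prop)
  refine Measurable.ite ?_ (h1.pow_const _) measurable_const
  exact (measurableSet_le h0 (h1.pow_const _)).inter
    ((measurableSet_lt measurable_const h1).inter (measurableSet_lt h1 measurable_const))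

/-- On the cusp ‖η‖ is comparable to |η 1|, and both terms of the numerator of the weight are O(|η
1|^(2δ)). -/
theorem weight_mul_cusp_sq_le (hδ : 1 ≤ δ) (hr : 0 < r) {η : Space 2}
    (h : |η 0| ≤ |η 1| ^ δ ∧ 0 < |η 1| ∧ |η 1| < 1 / 2) :
    weight s r δ η * cusp δ β η ^ 2 ≤
      (1 + 2 ^ (2 * δ)) * |η 1| ^ (2 * δ - 2 * r - 2 * β) := by
  obtain ⟨h0, hu, hu2⟩ := id h
  have hle : |η 0| ≤ |η 1| := h0.trans (by
    simpa using Real.rpow_le_rpow_of_exponent_ge hu (by linarith) hδ)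
  have hn := norm_sq_two η
  have e0 : η 0 ^ 2 ≤ |η 1| ^ 2 := by
    rw [← sq_abs]
    gcongr
  have e1 : η 1 ^ 2 = |η 1| ^ 2 := (sq_abs _).symm
  have hn2 : ‖η‖ ≤ 2 * |η 1| := by
    refine abs_le_of_sq_le_sq' ?_ (by positivity) |>.2
    nlinarith
  have hn1 : ‖η‖ < 1 := by linarith
  have hnl : |η 1| ≤ ‖η‖ := abs_coord_le_norm η 1
  have ed : η 0 ^ 2 ≤ |η 1| ^ (2 * δ) := by
    rw [← sq_abs, mul_comm, Real.rpow_mul hu.le, Real.rpow_two]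
    gcongr
  have en : ‖η‖ ^ (2 * δ) ≤ 2 ^ (2 * δ) * |η 1| ^ (2 * δ) := by
    rw [← Real.mul_rpow (by norm_num) hu.le]
    exact Real.rpow_le_rpow (norm_nonneg _) hn2 (by linarith)
  rw [weight_of_lt hn1, cusp, if_pos h]
  calc _ ≤ (|η 1| ^ (2 * δ) + 2 ^ (2 * δ) * |η 1| ^ (2 * δ)) / |η 1| ^ (2 * r) *
        (|η 1| ^ (-β)) ^ 2 := by gcongr
    _ = (1 + 2 ^ (2 * δ)) * (|η 1| ^ (2 * δ) / |η 1| ^ (2 * r) * (|η 1| ^ (-β)) ^ 2) := by ring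
    _ = _ := by
        rw [← Real.rpow_sub hu, ← Real.rpow_natCast, ← Real.rpow_mul hu.le, ← Real.rpow_add hu]
        congr 2
        push_cast
        ring

/-- The slice of the cusp at height u has width 2|u|^δ, which raises the exponent to 3δ - 2r - 2β;
the hypothesis says that it exceeds -1. -/
theorem energy_cusp_lt_top (hδ : 1 ≤ δ) (hr : 0 < r) (hβ : 2 * β < 3 * δ - 2 * r + 1) :
    energy s r δ (fun η => (cusp δ β η : ℂ)) < ⊤ := by
  obtain ⟨C, hC, h⟩ := exists_lintegral_norm_rpow_le (E := ℝ) volume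
    (b := -(3 * δ - 2 * r - 2 * β)) (by simp) (by
      simp only [Module.finrank_self, Nat.cast_one]
      linarith)
  have h1 := h 1 one_pos
  simp only [Real.one_rpow, ENNReal.ofReal_one, mul_one, neg_neg] at h1
  set K : ℝ := 1 + 2 ^ (2 * δ)
  have hK : 0 ≤ K := by positivity
  let g : ℝ → ℝ → ℝ≥0∞ := fun t u => (closedBall (0 : ℝ) 1).indicator
    (fun u => ENNReal.ofReal (K * |u| ^ (2 * δ - 2 * r - 2 * β))) u *
      {p : ℝ × ℝ | |p.1| ≤ |p.2| ^ δ}.indicator 1 (t, u)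
  have mabs : Measurable fun u : ℝ => |u| := continuous_abs.measurable
  have ms : MeasurableSet {p : ℝ × ℝ | |p.1| ≤ |p.2| ^ δ} :=
    measurableSet_le (mabs.comp measurable_fst) ((mabs.comp measurable_snd).pow_const _)
  have mg : Measurable (Function.uncurry g) :=
    (((((mabs.pow_const _).const_mul K).ennreal_ofReal).indicator
      measurableSet_closedBall).comp measurable_snd).mul (measurable_one.indicator ms)
  have hle : energy s r δ (fun η => (cusp δ β η : ℂ)) ≤ ∫⁻ η : Space 2, g (η 0) (η 1) := by
    refine lintegral_mono fun η => ?_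
    by_cases hη : |η 0| ≤ |η 1| ^ δ ∧ 0 < |η 1| ∧ |η 1| < 1 / 2
    · have hb : η 1 ∈ closedBall (0 : ℝ) 1 := by
        rw [mem_closedBall_zero_iff, Real.norm_eq_abs]
        linarith [hη.2.2]
      have hp : (η 0, η 1) ∈ {p : ℝ × ℝ | |p.1| ≤ |p.2| ^ δ} := hη.1
      have hw : 0 ≤ weight s r δ η := weight_nonneg (by linarith) η
      simp only [g]
      rw [Set.indicator_of_mem hb, Set.indicator_of_mem hp, Pi.one_apply, mul_one,
        ← ofReal_norm, Complex.norm_real, Real.norm_of_nonneg (cusp_nonneg η),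
        ← ENNReal.ofReal_pow (cusp_nonneg η), ← ENNReal.ofReal_mul hw]
      exact ENNReal.ofReal_le_ofReal (weight_mul_cusp_sq_le hδ hr hη)
    · have h0 : cusp δ β η = 0 := if_neg hη
      simp [h0]
  refine hle.trans_lt ?_
  rw [lintegral_space_two mg]
  have hin : ∀ u : ℝ, ∫⁻ t, g t u ≤ ENNReal.ofReal (2 * K) * (closedBall (0 : ℝ) 1).indicator
      (fun u => ENNReal.ofReal (‖u‖ ^ (3 * δ - 2 * r - 2 * β))) u := by
    intro u
    simp only [g]
    have hms : Measurable fun t : ℝ =>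
        {p : ℝ × ℝ | |p.1| ≤ |p.2| ^ δ}.indicator (1 : ℝ × ℝ → ℝ≥0∞) (t, u) :=
      (measurable_one.indicator ms).comp measurable_prodMk_right
    have hvol : ∫⁻ t : ℝ, {p : ℝ × ℝ | |p.1| ≤ |p.2| ^ δ}.indicator (1 : ℝ × ℝ → ℝ≥0∞) (t, u) =
        ENNReal.ofReal (2 * |u| ^ δ) := by
      have : ∀ t : ℝ, {p : ℝ × ℝ | |p.1| ≤ |p.2| ^ δ}.indicator (1 : ℝ × ℝ → ℝ≥0∞) (t, u) =
          (Set.Icc (-(|u| ^ δ)) (|u| ^ δ)).indicator 1 t := fun t => by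
        simp only [Set.indicator, Set.mem_ofPred_eq, Set.mem_Icc, abs_le, Pi.one_apply]
      simp only [this]
      rw [lintegral_indicator_one measurableSet_Icc, Real.volume_Icc]
      congr 1
      ring
    rw [lintegral_const_mul _ hms, hvol]
    by_cases hu : u ∈ closedBall (0 : ℝ) 1
    · rw [Set.indicator_of_mem hu, Set.indicator_of_mem hu, ← ENNReal.ofReal_mul (by positivity),
        ← ENNReal.ofReal_mul (by positivity)]
      refine ENNReal.ofReal_le_ofReal ?_
      rcases eq_or_ne u 0 with h0 | h0
      · rw [h0, abs_zero, Real.zero_rpow (by linarith : δ ≠ 0), mul_zero, mul_zero]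
        positivity
      · have hu0 : 0 < |u| := abs_pos.2 h0
        rw [Real.norm_eq_abs,
          show 3 * δ - 2 * r - 2 * β = (2 * δ - 2 * r - 2 * β) + δ by ring, Real.rpow_add hu0]
        refine le_of_eq ?_
        ring
    · rw [Set.indicator_of_notMem hu]
      simp
  refine (lintegral_mono hin).trans_lt ?_
  rw [lintegral_const_mul' _ _ ENNReal.ofReal_ne_top]
  exact ENNReal.mul_lt_top ENNReal.ofReal_lt_top (h1.trans_lt hC.lt_top)

theorem le_cusp (hδ : 0 ≤ δ) (hβ : 0 ≤ β) {R : ℝ} (hR : 0 < R) (hR8 : R ≤ 1 / 8) {η : Space 2}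
    (h0 : |η 0| ≤ R ^ δ) (h1 : R ≤ |η 1|) (h2 : |η 1| ≤ 3 * R) :
    (3 * R) ^ (-β) ≤ cusp δ β η := by
  have hu : 0 < |η 1| := hR.trans_le h1
  rw [cusp, if_pos ⟨h0.trans (Real.rpow_le_rpow hR.le h1 hδ), hu, by linarith⟩]
  exact Real.rpow_le_rpow_of_nonpos hu h2 (by linarith)

/-- For η in the box [0, R^δ] × [R, 2R], both η and ξ - η lie in the cusp, on opposite arms, at
heights between R and 3R. The bound 1/8 keeps 3R below 1/2. -/
theorem le_lintegral_cusp (hδ : 0 ≤ δ) (hβ : 0 ≤ β) {R : ℝ} (hR : 0 < R) (hR8 : R ≤ 1 / 8)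
    {ξ : Space 2} (h0 : ξ 0 ∈ Set.Icc 0 (R ^ δ)) (h1 : ξ 1 ∈ Set.Icc (-R) 0) :
    ENNReal.ofReal (((3 * R) ^ (-β)) ^ 2 * (R * R ^ δ)) ≤
      ∫⁻ η, ENNReal.ofReal (cusp δ β η * cusp δ β (ξ - η)) := by
  have hRd : 0 < R ^ δ := by positivity
  set Q : Set (Space 2) := {x | x 0 ∈ Set.Icc 0 (R ^ δ) ∧ x 1 ∈ Set.Icc R (2 * R)} with hQ
  have mQ : MeasurableSet Q :=
    ((by fun_prop : Measurable fun x : Space 2 => x 0) measurableSet_Icc).inter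
      ((by fun_prop : Measurable fun x : Space 2 => x 1) measurableSet_Icc)
  calc ENNReal.ofReal (((3 * R) ^ (-β)) ^ 2 * (R * R ^ δ))
      = ∫⁻ _ in Q, ENNReal.ofReal (((3 * R) ^ (-β)) ^ 2) := by
        rw [setLIntegral_const, hQ, volume_box, ← ENNReal.ofReal_mul (by linarith),
          ← ENNReal.ofReal_mul (by positivity)]
        congr 2
        ring
    _ ≤ ∫⁻ η in Q, ENNReal.ofReal (cusp δ β η * cusp δ β (ξ - η)) := by
        refine setLIntegral_mono' mQ fun η hη => ENNReal.ofReal_le_ofReal ?_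
        obtain ⟨⟨a1, a2⟩, b1, b2⟩ := hη
        obtain ⟨c1, c2⟩ := h0
        obtain ⟨d1, d2⟩ := h1
        have e1 : (3 * R) ^ (-β) ≤ cusp δ β η := by
          refine le_cusp hδ hβ hR hR8 ?_ ?_ ?_
          · rwa [abs_of_nonneg a1]
          · exact b1.trans (le_abs_self _)
          · rw [abs_of_nonneg (by linarith)]
            linarith
        have e2 : (3 * R) ^ (-β) ≤ cusp δ β (ξ - η) := by
          refine le_cusp hδ hβ hR hR8 ?_ ?_ ?_
          · rw [PiLp.sub_apply, abs_le]
            constructor <;> linarith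
          · rw [PiLp.sub_apply, abs_of_nonpos (by linarith)]
            linarith
          · rw [PiLp.sub_apply, abs_of_nonpos (by linarith)]
            linarith
        rw [sq]
        exact mul_le_mul e1 e2 (by positivity) (cusp_nonneg η)
    _ ≤ _ := setLIntegral_le_lintegral _ _

/-- Restrict to ξ of size about R^δ with first coordinate at least R^δ / 2: there the weight is at
least of order R^(2δ - 2rδ), the squared convolution R^(2 + 2δ - 4β), and the area is R^(2δ) / 2. -/
theorem le_energy_conv_cusp (hδ : 1 ≤ δ) (hr : 0 < r) (hβ : 0 ≤ β)
    (hint : Integrable (cusp δ β)) {R : ℝ} (hR : 0 < R) (hR8 : R ≤ 1 / 8) :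
    ENNReal.ofReal (1 / 8 * 2 ^ (-(2 * r)) * 3 ^ (-(4 * β)) *
      R ^ (6 * δ + 2 - 2 * r * δ - 4 * β)) ≤
      energy s r δ (conv (fun η => (cusp δ β η : ℂ)) (fun η => (cusp δ β η : ℂ))) := by
  have hRd : 0 < R ^ δ := by positivity
  have hRR : R ^ δ ≤ R := by
    simpa using Real.rpow_le_rpow_of_exponent_ge hR (by linarith) hδ
  set Q : Set (Space 2) := {x | x 0 ∈ Set.Icc (R ^ δ / 2) (R ^ δ) ∧ x 1 ∈ Set.Icc (-(R ^ δ)) 0}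
    with hQ
  have mQ : MeasurableSet Q :=
    ((by fun_prop : Measurable fun x : Space 2 => x 0) measurableSet_Icc).inter
      ((by fun_prop : Measurable fun x : Space 2 => x 1) measurableSet_Icc)
  set w : ℝ := (R ^ δ / 2) ^ 2 / (2 * R ^ δ) ^ (2 * r) with hw
  have hw0 : 0 ≤ w := by positivity
  set v : ℝ := ((3 * R) ^ (-β)) ^ 2 * (R * R ^ δ) with hv
  have hv0 : 0 ≤ v := by positivity
  calc _ = ∫⁻ _ in Q, ENNReal.ofReal (w * v ^ 2) := by
        rw [setLIntegral_const, hQ, volume_box, ← ENNReal.ofReal_mul (by linarith),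
          ← ENNReal.ofReal_mul (by positivity)]
        congr 1
        have e1 : w = 1 / 4 * 2 ^ (-(2 * r)) * (R ^ (2 * δ) * R ^ (-(2 * r * δ))) := by
          rw [hw, Real.mul_rpow (by norm_num) hRd.le, ← Real.rpow_mul hR.le,
            Real.rpow_neg (by norm_num : (0:ℝ) ≤ 2), Real.rpow_neg hR.le, mul_comm 2 δ,
            Real.rpow_mul hR.le δ 2, Real.rpow_two, mul_comm δ (2 * r)]
          field_simp
          ring
        have e2 : v ^ 2 = 3 ^ (-(4 * β)) * (R ^ (-(4 * β)) * (R ^ (2 : ℝ) * R ^ (2 * δ))) := by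
          have e3 : ((3 * R) ^ (-β)) ^ 4 = 3 ^ (-(4 * β)) * R ^ (-(4 * β)) := by
            rw [← Real.mul_rpow (by norm_num) hR.le, ← Real.rpow_natCast,
              ← Real.rpow_mul (by positivity)]
            congr 1
            push_cast
            ring
          have e4 : R ^ (2 * δ) = (R ^ δ) ^ 2 := by
            rw [mul_comm, Real.rpow_mul hR.le, Real.rpow_two]
          rw [← mul_assoc, ← e3, e4, Real.rpow_two, hv]
          ring
        have e5 : (0 - -(R ^ δ)) * (R ^ δ - R ^ δ / 2) = 1 / 2 * R ^ (2 * δ) := by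
          rw [mul_comm 2 δ, Real.rpow_mul hR.le, Real.rpow_two]
          ring
        rw [e1, e2, e5, show 6 * δ + 2 - 2 * r * δ - 4 * β =
          2 * δ + -(2 * r * δ) + (-(4 * β) + (2 + 2 * δ)) + 2 * δ by ring, Real.rpow_add hR,
          Real.rpow_add hR, Real.rpow_add hR, Real.rpow_add hR, Real.rpow_add hR]
        ring
    _ ≤ ∫⁻ ξ in Q, ENNReal.ofReal (weight s r δ ξ) *
          ‖conv (fun η => (cusp δ β η : ℂ)) (fun η => (cusp δ β η : ℂ)) ξ‖ₑ ^ 2 := by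
        refine setLIntegral_mono_ae' mQ ?_
        filter_upwards [ae_enorm_conv_ofReal hint cusp_nonneg] with ξ hξ hQξ
        obtain ⟨⟨a1, a2⟩, b1, b2⟩ := hQξ
        rw [hξ, ENNReal.ofReal_mul hw0, ENNReal.ofReal_pow hv0]
        have hn := norm_sq_two ξ
        have hn2 : ‖ξ‖ ≤ 2 * R ^ δ := by
          refine abs_le_of_sq_le_sq' ?_ (by positivity) |>.2
          nlinarith
        have hn0 : 0 < ‖ξ‖ := by
          have := abs_coord_le_norm ξ 0
          rw [abs_of_nonneg (by linarith)] at this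
          linarith
        gcongr
        · rw [weight_of_lt (by linarith), hw]
          have : 0 ≤ ‖ξ‖ ^ (2 * δ) := by positivity
          gcongr
          nlinarith
        · exact le_lintegral_cusp (by linarith) hβ hR hR8 ⟨by linarith, a2⟩ ⟨by linarith, b2⟩
    _ ≤ _ := setLIntegral_le_lintegral _ _

theorem energy_conv_cusp_eq_top (hδ : 1 ≤ δ) (hr : 0 < r) (hβ : 0 ≤ β)
    (hint : Integrable (cusp δ β)) (hexp : 6 * δ + 2 - 2 * r * δ - 4 * β < 0) :
    energy s r δ (conv (fun η => (cusp δ β η : ℂ)) (fun η => (cusp δ β η : ℂ))) = ⊤ := by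
  set e := 6 * δ + 2 - 2 * r * δ - 4 * β with he
  set c : ℝ := 1 / 8 * 2 ^ (-(2 * r)) * 3 ^ (-(4 * β)) with hc
  have hc0 : 0 < c := by positivity
  have hlim : Tendsto (fun x : ℝ => ENNReal.ofReal (c * x ^ (-e))) atTop (𝓝 ⊤) :=
    ENNReal.tendsto_ofReal_atTop.comp
      ((tendsto_rpow_atTop (by linarith)).const_mul_atTop hc0)
  refine top_le_iff.1 (le_of_tendsto hlim ?_)
  filter_upwards [eventually_ge_atTop 8] with x hx
  have hx0 : 0 < x := by linarith
  have h := le_energy_conv_cusp (s := s) hδ hr hβ hint (inv_pos.2 hx0)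
    (by rw [inv_le_comm₀ hx0 (by norm_num)]; simpa using hx)
  rwa [Real.inv_rpow hx0.le, ← Real.rpow_neg hx0.le] at h

end cusp

theorem not_closedUnderMul_of_two_lt {s r δ : ℝ} (hδ : 2 < δ) (hd : δ - 2 * r < 1) (hr1 : r ≤ 1)
    (hs : 1 < s) :
    ¬ ClosedUnderMul (d := 2) (X 2 s r δ) ∧ ¬ ClosedUnderMul (d := 2) (XReal 2 s r δ) := by
  have hr : 0 < r := by linarith
  -- 4β is the midpoint of the window from 6δ + 2 - 2rδ to 6δ + 2 - 4r, of length 2r(δ - 2) > 0.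
  set β : ℝ := (3 * δ - 2 * r + 1 - r * (δ - 2) / 2) / 2 with hβ
  have hpos : 0 < r * (δ - 2) := mul_pos hr (by linarith)
  have hb : ∀ w : Space 2 → ℂ, AEStronglyMeasurable w → energy s r δ w < ⊤ → Integrable w :=
    fun w hw => integrable_of_energy_lt_top
      (lintegral_inv_weight_lt_top (n := 1) one_pos (by linarith) (by simpa using hd)
        (by norm_num; linarith)) hw
  have hE : energy s r δ (fun η => (cusp δ β η : ℂ)) < ⊤ :=
    energy_cusp_lt_top (by linarith) hr (by rw [hβ]; linarith)
  have hint : Integrable (fun η => (cusp δ β η : ℂ)) :=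
    hb _ (Complex.measurable_ofReal.comp measurable_cusp).aestronglyMeasurable hE
  have hre : Integrable (cusp δ β) := by simpa using hint.re
  have hβ0 : 0 ≤ β := by
    rw [hβ]
    nlinarith
  refine not_closedUnderMul hint hE (fun ξ => by rw [cusp_neg, Complex.conj_ofReal]) ?_
  refine energy_conv_cusp_eq_top (by linarith) hr hβ0 hre ?_
  rw [hβ]
  linarith

end AnisoSobolev

end

/-! ### The main theorem -/

theorem mainTheorem1 (d : ℕ) [NeZero d] (s r δ : ℝ) (hδ : 1 < δ)
    (hd : 1 + δ - 2 * r < (d : ℝ)) (hr : r ≤ 1) (hs : (d : ℝ) / 2 < s) :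
    (3 ≤ d →
      AnisoSobolev.BoundedMul (d := d) (AnisoSobolev.X d s r δ) (AnisoSobolev.xNorm s r δ) ∧
      AnisoSobolev.BoundedMul (d := d) (AnisoSobolev.XReal d s r δ) (AnisoSobolev.xNorm s r δ)) ∧
    (d = 2 →
      (AnisoSobolev.BoundedMul (d := d) (AnisoSobolev.X d s r δ) (AnisoSobolev.xNorm s r δ)
        ↔ δ ≤ 2) ∧
      (AnisoSobolev.BoundedMul (d := d) (AnisoSobolev.XReal d s r δ) (AnisoSobolev.xNorm s r δ)
        ↔ δ ≤ 2) ∧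
      (AnisoSobolev.ClosedUnderMul (d := d) (AnisoSobolev.X d s r δ) ↔ δ ≤ 2) ∧
      (AnisoSobolev.ClosedUnderMul (d := d) (AnisoSobolev.XReal d s r δ) ↔ δ ≤ 2)) := by
  obtain ⟨n, rfl⟩ := Nat.exists_eq_succ_of_ne_zero (NeZero.ne d)
  have hd' : δ - 2 * r < n := by
    push_cast at hd
    linarith
  refine ⟨fun h3 => AnisoSobolev.boundedMul (by omega) hδ hd' hr hs (.inl (by omega)),
    fun h2 => ?_⟩
  obtain rfl : n = 1 := by omega
  -- For δ ≤ 2 the stronger bounded property holds, and for δ > 2 even closedness fails, so these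
  -- two facts yield all four equivalences.
  have pos : δ ≤ 2 → _ := fun h => AnisoSobolev.boundedMul one_pos hδ hd' hr hs (.inr h)
  have neg : 2 < δ → _ := fun h =>
    AnisoSobolev.not_closedUnderMul_of_two_lt h (by simpa using hd') hr
      (by norm_num at hs; exact hs)
  refine ⟨⟨fun h => ?_, fun h => (pos h).1⟩, ⟨fun h => ?_, fun h => (pos h).2⟩,
    ⟨fun h => ?_, fun h => (pos h).1.closedUnderMul⟩,
    ⟨fun h => ?_, fun h => (pos h).2.closedUnderMul⟩⟩ <;> by_contra! hlt
  · exact (neg hlt).1 h.closedUnderMul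
  · exact (neg hlt).2 h.closedUnderMul
  · exact (neg hlt).1 h
  · exact (neg hlt).2 h
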